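/- Let $F$ be the free group on $x,t$ and let $N$ be the normal subgroup of $F$ generated by $x$. Write $a^b=b^{-1}ab$. Let $w\in F$ be an element written in the form $$w=x^{m_1t^{d_1}}\cdots x^{m_rt^{d_r}},\qquad m_i,d_i\in\mathbb Z,$$ and suppose that $w\notin N'=[N,N]$. For $j\in\mathbb Z$ let $\tau_j(w)=\{i\mid d_i=j\}$, and let $S_w=\{j\mid \sum_{i\in\tau_j(w)}m_i\neq 0\}$; this set is finite and non-empty. Let $e_w$ and $d_w$ be its smallest and largest members, and put $A_w(X)=\sum_{i=1}^r m_iX^{d_i-e_w}\in\mathbb Z[X]$ (the terms with $d_i<e_w$ cancel). Suppose that $w$ is monic, that is: $\tau_j(w)=\emptyset$ for all $j>d_w$ and all $j<e_w$, the set $\tau_{d_w}(w)$ has exactly one element $k$, and $m_k=1$. If all complex roots of $A_w(X)$ are real and positive, then every group $G$ with presentation $\langle x,t\mid w\rangle$ is bi-orderable; that is, $G$ has a total order $<$ such that $u<v$ implies $ug<vg$ and $gu<gv$ for all $u,v,g\in G$. -/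

import Mathlib

namespace TwoGen

/-- A group is bi-orderable if it carries a total order that is invariant under
left and right multiplication. -/
def BiOrderable (G : Type*) [Group G] : Prop :=
  ∃ _ : LinearOrder G, ∀ u v g : G, u < v → u * g < v * g ∧ g * u < g * v

/-- The free group on the two generators `x` and `t`. -/
abbrev F : Type := FreeGroup (Fin 2)

/-- The generator `x`. -/
def x : F := FreeGroup.of 0

/-- The generator `t`. -/
def t : F := FreeGroup.of 1

/-- The normal subgroup of `F` generated by `x`. -/
def N : Subgroup F := Subgroup.normalClosure {x}

variable {r : ℕ}

/-- The element `x^{m₁ t^{d₁}} ⋯ x^{m_r t^{d_r}}` of `F`, where `a^b = b⁻¹ a b`. -/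
def word (m d : Fin r → ℤ) : F :=
  (List.ofFn fun i => (t ^ d i)⁻¹ * x ^ m i * t ^ d i).prod

/-- `τ_j`: the set of indices `i` with `d_i = j`. -/
def tau (d : Fin r → ℤ) (j : ℤ) : Finset (Fin r) :=
  Finset.univ.filter fun i => d i = j

/-- `S_w`: the set of those `j` for which the total exponent of `x^{t^j}` is non-zero. -/
def support (m d : Fin r → ℤ) : Set ℤ :=
  {j | ∑ i ∈ tau d j, m i ≠ 0}

/-- `e_w`: the smallest member of `S_w`. -/
noncomputable def low (m d : Fin r → ℤ) : ℤ := sInf (support m d)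

/-- `d_w`: the largest member of `S_w`. -/
noncomputable def top (m d : Fin r → ℤ) : ℤ := sSup (support m d)

/-- `A_w(X) = ∑ i, m_i X^{d_i - e_w}`. (The terms with `d_i < e_w` cancel, since for each `j < e_w`
the `m_i` with `d_i = j` add up to `0`; so the value of `Int.toNat` there is irrelevant.) -/
noncomputable def poly (m d : Fin r → ℤ) : Polynomial ℤ :=
  ∑ i, Polynomial.C (m i) * Polynomial.X ^ (d i - low m d).toNat

/-- The expression is tidy: `w ∈ N \ N'` and `τ_j` is empty for `j > d_w` and for `j < e_w`. -/
def IsTidy (m d : Fin r → ℤ) : Prop :=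
  (word m d ∈ N ∧ word m d ∉ ⁅N, N⁆) ∧
    ∀ j : ℤ, (top m d < j ∨ j < low m d) → tau d j = ∅

/-- The expression is principal: it is tidy and `τ_{d_w}` has exactly one element. -/
def IsPrincipal (m d : Fin r → ℤ) : Prop :=
  IsTidy m d ∧ ∃ k, tau d (top m d) = {k}

/-- The expression is monic: it is principal and `m_k = 1` for the element `k` of `τ_{d_w}`. -/
def IsMonic (m d : Fin r → ℤ) : Prop :=
  IsPrincipal m d ∧ ∀ k ∈ tau d (top m d), m k = 1

theorem support_finite (m d : Fin r → ℤ) : (support m d).Finite := by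
  refine (Finset.univ.image d).finite_toSet.subset fun j hj => ?_
  obtain ⟨i, hi, -⟩ := Finset.exists_ne_zero_of_sum_ne_zero hj
  simp only [tau, Finset.mem_filter, Finset.mem_univ, true_and] at hi
  simp [← hi]

theorem conj_mem_N (j : ℤ) : (t ^ j)⁻¹ * x * t ^ j ∈ N := by
  have h : x ∈ N := Subgroup.subset_normalClosure rfl
  have hn : N.Normal := Subgroup.normalClosure_normal
  simpa using hn.conj_mem x h (t ^ j)⁻¹

/-- If `w` is not in `N'`, then `S_w` is non-empty, so that `e_w` and `d_w` make sense. -/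
theorem support_nonempty (m d : Fin r → ℤ) (h : word m d ∉ ⁅N, N⁆) :
    (support m d).Nonempty := by
  by_contra hS
  apply h
  let y : ℤ → N := fun j => ⟨(t ^ j)⁻¹ * x * t ^ j, conj_mem_N j⟩
  let n : N := (List.ofFn fun i => y (d i) ^ m i).prod
  have hn : (n : F) = word m d := by
    have hc : ∀ i, ((y (d i) : F)) ^ m i = (t ^ d i)⁻¹ * x ^ m i * t ^ d i := by
      intro i
      have := conj_zpow (i := m i) (a := (t ^ d i)⁻¹) (b := x)
      simpa [y] using this
    have : (n : F) = N.subtype n := rfl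
    rw [this, map_list_prod, List.map_ofFn, word]
    congr 2
    funext i
    simpa using hc i
  have h0 : ∀ j, ∑ i ∈ tau d j, m i = 0 := by
    intro j
    by_contra hj
    exact hS ⟨j, hj⟩
  have h1 : Abelianization.of n = 1 := by
    rw [map_list_prod, List.map_ofFn, List.prod_ofFn,
      ← Finset.prod_fiberwise_of_maps_to (t := Finset.univ.image d) (g := d)
        (fun i hi => Finset.mem_image_of_mem d hi)]
    refine Finset.prod_eq_one fun j _ => ?_
    calc ∏ i ∈ Finset.univ.filter (fun i => d i = j), (Abelianization.of ∘ fun i => y (d i) ^ m i) i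
        = ∏ i ∈ tau d j, Abelianization.of (y j) ^ m i := by
          refine Finset.prod_congr rfl fun i hi => ?_
          replace hi : d i = j := (Finset.mem_filter.1 hi).2
          rw [Function.comp_apply, hi, map_zpow]
      _ = Abelianization.of (y j) ^ ∑ i ∈ tau d j, m i := by
          induction tau d j using Finset.induction_on with
          | empty => simp
          | insert a s ha ih => rw [Finset.prod_insert ha, Finset.sum_insert ha, zpow_add, ih]
      _ = 1 := by rw [h0, zpow_zero]
  have h2 : n ∈ commutator N := by
    rw [← Abelianization.ker_of]
    exact h1
  rw [← hn, ← Subgroup.map_subtype_commutator]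
  exact Subgroup.mem_map_of_mem N.subtype h2

theorem isLeast_low (m d : Fin r → ℤ) (h : word m d ∉ ⁅N, N⁆) :
    IsLeast (support m d) (low m d) :=
  ⟨Int.csInf_mem (support_nonempty m d h) (support_finite m d).bddBelow,
    fun _ hj => csInf_le (support_finite m d).bddBelow hj⟩

theorem isGreatest_top (m d : Fin r → ℤ) (h : word m d ∉ ⁅N, N⁆) :
    IsGreatest (support m d) (top m d) :=
  ⟨Int.csSup_mem (support_nonempty m d h) (support_finite m d).bddAbove,
    fun _ hj => le_csSup (support_finite m d).bddAbove hj⟩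

end TwoGen

/-!
In `G = ⟨x, t ∣ w⟩` write `x_j = x^{t^j}`, `e = e_w` and `n = d_w - e_w`. As `w` is monic, the relation
`w = 1` says that `x_{e+n}` equals a word `W` in the block `x_e, …, x_{e+n-1}`, so `G` is an ascending
extension of the block by the endomorphism `x_j ↦ x_{j+1}`, `x_{e+n-1} ↦ W`. On the abelianization of
the free group of rank `n` this endomorphism is the companion matrix of `A_w`, whose eigenvalues are
real and positive.

The group `G` is embedded in a semidirect product `U ⋊ ℤ`, where `U` is bi-ordered and `ℤ` acts on it
by order-preserving automorphisms. The lexicographic order of the semidirect product is then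
bi-invariant (`TwoGen.biOrderable_semidirectProduct`).

* Let `A` be the tensor algebra of `V = ℝⁿ`. The group `U` consists of the power series over `A`, in
  one central variable `X`, with constant coefficient `1`. For any order on the additive group
  `A`, comparing the first coefficients that differ is a bi-invariant order on `U`,
  since multiplication by a series with constant coefficient `1` does not change leading coefficients
  of differences (`PowerSeries.unipotentOrder_lt_mul`).
* Let `T` be an operator on `V` with the roots of `A_w` as eigenvalues and cyclic vector `v₀`, and
  put `vᵢ = Tⁱ v₀`. The Magnus map `x_{e+i} ↦ 1 + vᵢX`, for `i < n`, is injective on the free group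
  (`magnus_injective`).
* The shift of the block extends to an automorphism `Θ` of `A⟦X⟧` because its reduction modulo `X`
  is the automorphism of `A` induced by `T` (`PowerSeries.bindEquiv`); here `A_w(T) v₀ = 0` is what
  makes `W` fit. In a basis of `V` for which `T` is triangular, the monomials, ordered
  lexicographically, are a basis of `A` in which the induced map is triangular with positive
  diagonal. So it preserves the order on `A` given by the sign of the first non-zero coordinate,
  and `Θ` preserves the order on `U` (`exists_ordered_group_of_freeGroup`).

Finally `x ↦ Θ^{-e}(1 + v₀X)` and the generator `t` of `ℤ`, with `t⁻¹` acting as `Θ`, define a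
homomorphism on `G`. It is injective because every element of `G` is, up to a power of `t`, conjugate
into the block (`TwoGen.exists_conj_block`), on which the homomorphism is the Magnus map.
-/

section NoncommutativePowerSeries

open PowerSeries
open Finset.HasAntidiagonal (antidiagonal mem_antidiagonal)

/-! ### Extending ring homomorphisms to power series -/

section PowerSeriesBind

variable {A : Type*} [Ring A]

/-- The sum over `(a + b) + (c + d) = n` may be regrouped as `(a + c) + (b + d) = n`. -/
theorem sum_antidiagonal_four {M : Type*} [AddCommMonoid M] (f : ℕ → ℕ → ℕ → ℕ → M) (n : ℕ) :
    ∑ p ∈ antidiagonal n, ∑ q ∈ antidiagonal p.1, ∑ r ∈ antidiagonal p.2,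
        f q.1 q.2 r.1 r.2 =
      ∑ p ∈ antidiagonal n, ∑ q ∈ antidiagonal p.1, ∑ r ∈ antidiagonal p.2,
        f q.1 r.1 q.2 r.2 := by
  simp_rw [← Finset.sum_product', Finset.sum_sigma']
  refine Finset.sum_bij'
    (fun x _ => ⟨(x.2.1.1 + x.2.2.1, x.2.1.2 + x.2.2.2), ((x.2.1.1, x.2.2.1), (x.2.1.2, x.2.2.2))⟩)
    (fun x _ => ⟨(x.2.1.1 + x.2.2.1, x.2.1.2 + x.2.2.2), ((x.2.1.1, x.2.2.1), (x.2.1.2, x.2.2.2))⟩)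
    ?_ ?_ ?_ ?_ ?_
  · rintro ⟨⟨a, b⟩, ⟨⟨c, d⟩, ⟨e, g⟩⟩⟩ h
    simp only [Finset.mem_sigma, mem_antidiagonal, Finset.mem_product] at h ⊢
    exact ⟨by omega, trivial, trivial⟩
  · rintro ⟨⟨a, b⟩, ⟨⟨c, d⟩, ⟨e, g⟩⟩⟩ h
    simp only [Finset.mem_sigma, mem_antidiagonal, Finset.mem_product] at h ⊢
    exact ⟨by omega, trivial, trivial⟩
  · rintro ⟨⟨a, b⟩, ⟨⟨c, d⟩, ⟨e, g⟩⟩⟩ h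
    simp only [Finset.mem_sigma, mem_antidiagonal, Finset.mem_product] at h
    obtain ⟨h1, h2, h3⟩ := h
    subst h2; subst h3; rfl
  · rintro ⟨⟨a, b⟩, ⟨⟨c, d⟩, ⟨e, g⟩⟩⟩ h
    simp only [Finset.mem_sigma, mem_antidiagonal, Finset.mem_product] at h
    obtain ⟨h1, h2, h3⟩ := h
    subst h2; subst h3; rfl
  · rintro ⟨⟨a, b⟩, ⟨⟨c, d⟩, ⟨e, g⟩⟩⟩ h
    rfl

/-- The endomorphism `∑ aₙ Xⁿ ↦ ∑ θ(aₙ) Xⁿ` of `A⟦X⟧` induced by a ring homomorphism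
`θ : A → A⟦X⟧`. -/
noncomputable def PowerSeries.bindHom (θ : A →+* A⟦X⟧) : A⟦X⟧ →+* A⟦X⟧ where
  toFun f := PowerSeries.mk fun n => ∑ p ∈ antidiagonal n, coeff p.2 (θ (coeff p.1 f))
  map_zero' := by ext n; simp
  map_one' := by
    ext n
    rw [coeff_mk, Finset.sum_eq_single (0, n)]
    · simp
    · rintro ⟨a, b⟩ h hne
      have : a ≠ 0 := by
        rintro rfl
        simp only [mem_antidiagonal, zero_add] at h
        exact hne (by rw [h])
      simp [coeff_one, this]
    · simp
  map_add' f g := by ext n; simp [Finset.sum_add_distrib]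
  map_mul' f g := by
    ext n
    simp only [coeff_mk, coeff_mul, map_sum, map_mul]
    simp_rw [Finset.sum_mul_sum]
    have := sum_antidiagonal_four
      (fun a b c d => coeff c (θ (coeff a f)) * coeff d (θ (coeff b g))) n
    rw [← this]

theorem PowerSeries.coeff_bindHom (θ : A →+* A⟦X⟧) (f : A⟦X⟧) (n : ℕ) :
    coeff n (bindHom θ f) =
      ∑ p ∈ antidiagonal n, coeff p.2 (θ (coeff p.1 f)) := by
  simp [bindHom]

@[simp]
theorem PowerSeries.bindHom_C (θ : A →+* A⟦X⟧) (a : A) : bindHom θ (C a) = θ a := by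
  ext n
  rw [coeff_bindHom, Finset.sum_eq_single (0, n)]
  · simp
  · rintro ⟨p, q⟩ h hne
    have : p ≠ 0 := by
      rintro rfl
      simp only [mem_antidiagonal, zero_add] at h
      exact hne (by rw [h])
    simp [coeff_C, this]
  · simp

@[simp]
theorem PowerSeries.bindHom_X (θ : A →+* A⟦X⟧) : bindHom θ X = X := by
  ext n
  rw [coeff_bindHom]
  rcases n with _ | n
  · simp
  · rw [Finset.sum_eq_single (1, n)]
    · simp [coeff_X, coeff_one]
    · rintro ⟨p, q⟩ h hne
      have : p ≠ 1 := by
        rintro rfl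
        simp only [mem_antidiagonal] at h
        exact hne (by rw [show q = n by omega])
      simp [coeff_X, this]
    · intro h
      simp [mem_antidiagonal] at h
      omega

/-- The leading coefficient only sees the reduction of `θ` modulo `X`. -/
theorem PowerSeries.coeff_bindHom_of_lt (θ : A →+* A⟦X⟧) {f : A⟦X⟧} {n : ℕ}
    (h : ∀ m < n, coeff m f = 0) :
    coeff n (bindHom θ f) = constantCoeff (θ (coeff n f)) := by
  rw [coeff_bindHom, Finset.sum_eq_single (n, 0)]
  · simp
  · rintro ⟨p, q⟩ hp hne
    have : p < n := by
      simp only [mem_antidiagonal] at hp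
      rcases Nat.eq_zero_or_pos q with rfl | hq
      · exact absurd (by rw [← hp]; rfl) hne
      · omega
    simp [h p this]
  · simp

theorem PowerSeries.constantCoeff_bindHom (θ : A →+* A⟦X⟧) (f : A⟦X⟧) :
    constantCoeff (bindHom θ f) = constantCoeff (θ (constantCoeff f)) := by
  simpa using coeff_bindHom_of_lt θ (f := f) (n := 0) (by simp)

theorem PowerSeries.bindHom_injective {θ : A →+* A⟦X⟧}
    (h : Function.Injective fun a => constantCoeff (θ a)) :
    Function.Injective (bindHom θ) := by
  refine (injective_iff_map_eq_zero _).2 fun f hf => ?_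
  ext n
  induction n using Nat.strong_induction_on with
  | _ n ih =>
    have := coeff_bindHom_of_lt θ (f := f) (n := n) (by simpa using ih)
    rw [hf, map_zero] at this
    exact h (by simpa using this.symm)

/-- The coefficients of a preimage are found one after the other. -/
theorem PowerSeries.bindHom_surjective {θ : A →+* A⟦X⟧}
    (h : Function.Surjective fun a => constantCoeff (θ a)) :
    Function.Surjective (bindHom θ) := by
  intro g
  choose s hs using h
  let c : ℕ → A := fun n => Nat.strongRec (motive := fun _ => A)
    (fun n r => s (coeff n g - ∑ k : Fin n, coeff (n - k) (θ (r k k.2)))) n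
  have hc : ∀ n, c n = s (coeff n g - ∑ k ∈ Finset.range n, coeff (n - k) (θ (c k))) := by
    intro n
    have : c n = s (coeff n g - ∑ k : Fin n, coeff (n - k) (θ (c k))) := by
      simp only [c]
      rw [Nat.strongRec]
    rw [this, ← Fin.sum_univ_eq_sum_range (fun k => coeff (n - k) (θ (c k)))]
  refine ⟨PowerSeries.mk c, ?_⟩
  ext n
  rw [coeff_bindHom,
    Finset.Nat.sum_antidiagonal_eq_sum_range_succ (fun i j => coeff j (θ (coeff i (mk c)))),
    Finset.sum_range_succ]
  simp only [coeff_mk, Nat.sub_self]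
  have h2 : coeff 0 (θ (c n)) = coeff n g - ∑ k ∈ Finset.range n, coeff (n - k) (θ (c k)) := by
    conv_lhs => rw [hc n]
    simpa using hs _
  rw [h2]
  abel

/-- The automorphism of `A⟦X⟧` induced by `θ : A → A⟦X⟧` when `θ` is bijective modulo `X`. -/
noncomputable def PowerSeries.bindEquiv (θ : A →+* A⟦X⟧)
    (h : Function.Bijective fun a => constantCoeff (θ a)) : A⟦X⟧ ≃+* A⟦X⟧ :=
  RingEquiv.ofBijective (bindHom θ) ⟨bindHom_injective h.1, bindHom_surjective h.2⟩

end PowerSeriesBind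

/-! ### The lexicographic order on power series -/

section PowerSeriesLex

variable {A : Type*} [Ring A] [LinearOrder A]

/-- A power series is positive when its first non-zero coefficient is. -/
def PowerSeries.LexPos (f : A⟦X⟧) : Prop :=
  ∃ n, (∀ m < n, coeff m f = 0) ∧ 0 < coeff n f

theorem PowerSeries.LexPos.mul_right {f g : A⟦X⟧} (hf : LexPos f) (hg : constantCoeff g = 1) :
    LexPos (f * g) := by
  obtain ⟨n, h0, hn⟩ := hf
  have key : ∀ m ≤ n, coeff m (f * g) = coeff m f := by
    intro m hm
    rw [coeff_mul, Finset.sum_eq_single (m, 0)]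
    · simp [hg]
    · rintro ⟨p, q⟩ hp hne
      have : p < n := by
        simp only [mem_antidiagonal] at hp
        rcases Nat.eq_zero_or_pos q with rfl | hq
        · exact absurd (by rw [← hp]; rfl) hne
        · omega
      simp [h0 p this]
    · simp
  exact ⟨n, fun m hm => by rw [key m hm.le, h0 m hm], by rwa [key n le_rfl]⟩

theorem PowerSeries.LexPos.mul_left {f g : A⟦X⟧} (hf : LexPos f) (hg : constantCoeff g = 1) :
    LexPos (g * f) := by
  obtain ⟨n, h0, hn⟩ := hf
  have key : ∀ m ≤ n, coeff m (g * f) = coeff m f := by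
    intro m hm
    rw [coeff_mul, Finset.sum_eq_single (0, m)]
    · simp [hg]
    · rintro ⟨p, q⟩ hp hne
      have : q < n := by
        simp only [mem_antidiagonal] at hp
        rcases Nat.eq_zero_or_pos p with rfl | hq
        · exact absurd (by rw [← hp, zero_add]) hne
        · omega
      simp [h0 q this]
    · simp
  exact ⟨n, fun m hm => by rw [key m hm.le, h0 m hm], by rwa [key n le_rfl]⟩

theorem PowerSeries.LexPos.bindHom {θ : A →+* A⟦X⟧}
    (hθ : ∀ a : A, 0 < a → 0 < constantCoeff (θ a)) {f : A⟦X⟧} (hf : LexPos f) :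
    LexPos (bindHom θ f) := by
  obtain ⟨n, h0, hn⟩ := hf
  refine ⟨n, fun m hm => ?_, ?_⟩
  · rw [coeff_bindHom_of_lt θ fun k hk => h0 k (hk.trans hm), h0 m hm]
    simp
  · rw [coeff_bindHom_of_lt θ h0]
    exact hθ _ hn

theorem PowerSeries.LexPos.add [IsOrderedAddMonoid A] {f g : A⟦X⟧} (hf : LexPos f) (hg : LexPos g) :
    LexPos (f + g) := by
  obtain ⟨n, h0, hn⟩ := hf
  obtain ⟨k, k0, hk⟩ := hg
  rcases lt_trichotomy n k with h | rfl | h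
  · exact ⟨n, fun m hm => by simp [h0 m hm, k0 m (hm.trans h)], by simpa [k0 n h] using hn⟩
  · exact ⟨n, fun m hm => by simp [h0 m hm, k0 m hm], by simpa using add_pos hn hk⟩
  · exact ⟨k, fun m hm => by simp [k0 m hm, h0 m (hm.trans h)], by simpa [h0 k h] using hk⟩

theorem PowerSeries.not_lexPos_zero : ¬ LexPos (0 : A⟦X⟧) := by
  rintro ⟨n, -, h⟩
  simp at h

theorem PowerSeries.lexPos_or_lexPos_neg [IsOrderedAddMonoid A] {f : A⟦X⟧} (hf : f ≠ 0) :
    LexPos f ∨ LexPos (-f) := by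
  classical
  have hex : ∃ n, coeff n f ≠ 0 := by
    by_contra! h
    exact hf (PowerSeries.ext (by simpa using h))
  have hmin : ∀ m < Nat.find hex, coeff m f = 0 := fun m hm => by
    simpa using Nat.find_min hex hm
  rcases (Nat.find_spec hex).lt_or_gt with h | h
  · exact Or.inr ⟨_, fun m hm => by simp [hmin m hm], by simpa using h⟩
  · exact Or.inl ⟨_, hmin, h⟩

end PowerSeriesLex

/-! ### The Magnus representation of a free group -/

section Magnus

variable {A : Type*} [Ring A]

/-- The unit `1 + aX` of `A⟦X⟧`, where `a` need not commute with other elements of `A`. -/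
noncomputable def PowerSeries.oneAddUnit (a : A) : A⟦X⟧ˣ where
  val := 1 + X * C a
  inv := mk fun n => (-a) ^ n
  val_inv := by
    rw [add_mul, one_mul, mul_assoc]
    ext n
    rcases n with _ | n
    · simp
    · simp only [map_add, coeff_succ_X_mul, coeff_C_mul, coeff_mk, coeff_one]
      simp [pow_succ']
  inv_val := by
    rw [mul_add, mul_one, ← mul_assoc, ← X_mul, mul_assoc]
    ext n
    rcases n with _ | n
    · simp
    · simp only [map_add, coeff_succ_X_mul, coeff_mul_C, coeff_mk, coeff_one]
      simp [pow_succ]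

/-- The Magnus representation, which sends the `i`-th generator to `1 + vᵢX`. -/
noncomputable def magnus {ι : Type*} (v : ι → A) : FreeGroup ι →* A⟦X⟧ˣ :=
  FreeGroup.lift fun i => oneAddUnit (v i)

@[simp]
theorem magnus_of {ι : Type*} (v : ι → A) (i : ι) :
    magnus v (FreeGroup.of i) = oneAddUnit (v i) := by
  simp [magnus]

theorem constantCoeff_oneAddUnit (a : A) : constantCoeff (oneAddUnit a : A⟦X⟧) = 1 := by
  simp [oneAddUnit]

theorem coeff_one_oneAddUnit (a : A) : coeff 1 (oneAddUnit a : A⟦X⟧) = a := by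
  simp [oneAddUnit, coeff_one, coeff_succ_X_mul 0]

theorem constantCoeff_magnus {ι : Type*} (v : ι → A) (h : FreeGroup ι) :
    constantCoeff (magnus v h : A⟦X⟧) = 1 := by
  have : (Units.map (constantCoeff (R := A)).toMonoidHom).comp (magnus v) = 1 := by
    ext i
    simp [constantCoeff_oneAddUnit]
  simpa using congrArg Units.val (DFunLike.congr_fun this h)

theorem coeff_one_mul_of_constantCoeff {f g : A⟦X⟧} (hf : constantCoeff f = 1)
    (hg : constantCoeff g = 1) : coeff 1 (f * g) = coeff 1 f + coeff 1 g := by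
  rw [coeff_mul, Finset.Nat.antidiagonal_succ]
  simp [hf, hg, add_comm]

/-- The linear coefficient of a Magnus series is additive. -/
noncomputable def magnusLinear {ι : Type*} (v : ι → A) : FreeGroup ι →* Multiplicative A where
  toFun h := Multiplicative.ofAdd (coeff 1 (magnus v h : A⟦X⟧))
  map_one' := by simp [coeff_one]
  map_mul' g h := by
    simp [coeff_one_mul_of_constantCoeff (constantCoeff_magnus v g) (constantCoeff_magnus v h)]

theorem magnusLinear_of {ι : Type*} (v : ι → A) (i : ι) :
    magnusLinear v (FreeGroup.of i) = Multiplicative.ofAdd (v i) := by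
  simp [magnusLinear, coeff_one_oneAddUnit]

theorem coeff_one_magnus {ι : Type*} (v : ι → A) (h : FreeGroup ι) :
    coeff 1 (magnus v h : A⟦X⟧) = (magnusLinear v h).toAdd := rfl

theorem oneAddUnit_zpow_of_sq_eq_zero {a : A} (ha : a * a = 0) (k : ℤ) :
    oneAddUnit a ^ k = oneAddUnit ((k : A) * a) := by
  have key : ∀ k l : ℤ, oneAddUnit ((k : A) * a) * oneAddUnit ((l : A) * a) =
      oneAddUnit (((k + l : ℤ) : A) * a) := by
    intro k l
    ext1
    simp only [oneAddUnit, Units.val_mul]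
    have : (X * C ((k : A) * a)) * (X * C ((l : A) * a)) = (0 : A⟦X⟧) := by
      have h0 : (k : A) * a * ((l : A) * a) = 0 := by
        rw [mul_assoc, ← mul_assoc a, (Int.cast_commute l a).symm.eq, mul_assoc, ha]
        simp
      calc (X * C ((k : A) * a)) * (X * C ((l : A) * a))
          = X * X * (C ((k : A) * a) * C ((l : A) * a)) := by
            rw [mul_assoc, ← mul_assoc (C _) X, ← X_mul, mul_assoc, mul_assoc]
        _ = 0 := by rw [← map_mul, h0]; simp
    rw [add_mul, one_mul, mul_add, this]
    push_cast
    rw [add_mul, map_add, mul_add]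
    simp only [mul_one, add_zero]
    abel
  let φ : Multiplicative ℤ →* A⟦X⟧ˣ :=
    { toFun := fun k => oneAddUnit (((k.toAdd : ℤ) : A) * a)
      map_one' := by ext1; simp [oneAddUnit]
      map_mul' := fun k l => (key _ _).symm }
  have h1 : φ (Multiplicative.ofAdd 1) = oneAddUnit a := by simp [φ]
  have h2 := map_zpow φ (Multiplicative.ofAdd 1) k
  rw [h1, ← ofAdd_zsmul] at h2
  rw [← h2]
  simp [φ]

/-- In a product of `n` linear factors `1 + aX`, the coefficient of `Xⁿ` is the product of the
linear coefficients, and there are no higher terms. -/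
theorem coeff_prod_oneAddUnit (l : List A) :
    (∀ n, l.length < n → coeff n ((l.map oneAddUnit).prod : A⟦X⟧ˣ).val = 0) ∧
      coeff l.length ((l.map oneAddUnit).prod : A⟦X⟧ˣ).val = l.prod := by
  induction l with
  | nil => exact ⟨fun n hn => by simp at hn; simp [coeff_one, hn.ne'], by simp⟩
  | cons a l ih =>
    have hc : ∀ n, coeff (n + 1) (((a :: l).map oneAddUnit).prod : A⟦X⟧ˣ).val =
        coeff (n + 1) ((l.map oneAddUnit).prod : A⟦X⟧ˣ).val +
          a * coeff n ((l.map oneAddUnit).prod : A⟦X⟧ˣ).val := by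
      intro n
      rw [List.map_cons, List.prod_cons, Units.val_mul]
      conv_lhs => rw [oneAddUnit]
      simp [add_mul, mul_assoc, coeff_succ_X_mul]
    constructor
    · intro n hn
      obtain ⟨n, rfl⟩ : ∃ k, n = k + 1 := ⟨n - 1, by simp at hn; omega⟩
      simp only [List.length_cons] at hn
      rw [hc, ih.1 _ (by omega), ih.1 _ (by omega)]
      simp
    · rw [List.length_cons, hc, ih.2, ih.1 _ (by omega)]
      simp

theorem freeGroup_unit_eq_zpow (g : FreeGroup Unit) : ∃ k : ℤ, g = FreeGroup.of () ^ k :=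
  ⟨FreeGroup.freeGroupUnitEquivInt g, (FreeGroup.freeGroupUnitEquivInt.symm_apply_apply g).symm⟩

/-- Every non-trivial element of a free group is a non-empty product of non-trivial powers of
generators in which neighbouring generators differ. -/
theorem FreeGroup.exists_syllables {ι : Type*} (h : FreeGroup ι) :
    ∃ l : List (ι × ℤ), h = (l.map fun p => FreeGroup.of p.1 ^ p.2).prod ∧
      (∀ p ∈ l, p.2 ≠ 0) ∧ l.IsChain (fun p q => p.1 ≠ q.1) := by
  classical
  choose e he using freeGroup_unit_eq_zpow
  let w := Monoid.CoprodI.Word.equiv (freeGroupEquivCoprodI h)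
  have hw : w.prod = freeGroupEquivCoprodI h := Monoid.CoprodI.Word.equiv.symm_apply_apply _
  refine ⟨w.toList.map fun p => (p.1, e p.2), ?_, ?_, ?_⟩
  · apply freeGroupEquivCoprodI.injective
    rw [← hw, map_list_prod, List.map_map, List.map_map, Monoid.CoprodI.Word.prod]
    congr 1
    refine List.map_congr_left fun p _ => ?_
    simp only [Function.comp_apply, map_zpow]
    conv_lhs => rw [he p.2]
    simp
  · intro p hp
    obtain ⟨q, hq, rfl⟩ := List.mem_map.1 hp
    intro h0
    apply w.ne_one q hq
    rw [he q.2]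
    simp only at h0
    simp [h0]
  · rw [List.isChain_map]
    exact w.chain_ne

/-- The shift operator that recognises the letter `i` of the sequence `c`: it sends a function `f`
on `ℕ` to the function with value `f (n + 1)` at the places `n` with `c n = i`, and `0`
elsewhere. -/
def letterShift {ι : Type*} [DecidableEq ι] (c : ℕ → Option ι) (i : ι) :
    Module.End ℝ (ℕ → ℝ) where
  toFun f n := if c n = some i then f (n + 1) else 0
  map_add' f g := by ext n; by_cases h : c n = some i <;> simp [h]
  map_smul' a f := by ext n; by_cases h : c n = some i <;> simp [h]

theorem letterShift_mul_self {ι : Type*} [DecidableEq ι] {c : ℕ → Option ι}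
    (hc : ∀ n i, c n = some i → c (n + 1) ≠ some i) (i : ι) :
    letterShift c i * letterShift c i = 0 := by
  ext f n
  simp only [letterShift, Module.End.mul_apply, LinearMap.coe_mk, AddHom.coe_mk,
    LinearMap.zero_apply, Pi.zero_apply, ite_eq_right_iff]
  intro h1 h2
  exact absurd h2 (hc n i h1)

theorem prod_letterShift_apply {ι : Type*} [DecidableEq ι] {c : ℕ → Option ι}
    (l : List (ι × ℤ)) (f : ℕ → ℝ) (j : ℕ)
    (h : ∀ n (hn : n < l.length), c (j + n) = some l[n].1) :
    (l.map fun p => (p.2 : Module.End ℝ (ℕ → ℝ)) * letterShift c p.1).prod f j =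
      (l.map fun p => (p.2 : ℝ)).prod * f (j + l.length) := by
  induction l generalizing j with
  | nil => simp
  | cons p l ih =>
    have h0 : c j = some p.1 := h 0 (by simp)
    have ih' := ih (j + 1) fun n hn => by
      have := h (n + 1) (by simpa using hn)
      rw [add_assoc, add_comm 1 n]
      simpa using this
    have e1 : ∀ (k : ℤ) (g : ℕ → ℝ) (i : ℕ), (k : Module.End ℝ (ℕ → ℝ)) g i = (k : ℝ) * g i := by
      intro k g i
      rw [Module.End.intCast_apply]
      simp
    rw [List.map_cons, List.prod_cons, Module.End.mul_apply, Module.End.mul_apply, e1]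
    simp only [letterShift, LinearMap.coe_mk, AddHom.coe_mk, h0, if_true]
    simp only [letterShift] at ih'
    rw [ih']
    simp only [List.map_cons, List.prod_cons, List.length_cons]
    rw [mul_assoc, add_assoc, add_comm 1]

/-- The Magnus representation is faithful as soon as the linear terms `vᵢ` can be specialised
arbitrarily in `End(ℝ^ℕ)`: a word with syllables `i₁, …, i_r` is detected by the operators
`letterShift`, which have square zero, so that only the product of the linear terms of the syllables
contributes to the coefficient of `X^r`. -/
theorem magnus_injective {ι : Type*} (v : ι → A)
    (hv : ∀ M : ι → Module.End ℝ (ℕ → ℝ), ∃ ρ : A →+* Module.End ℝ (ℕ → ℝ), ∀ i, ρ (v i) = M i) :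
    Function.Injective (magnus v) := by
  classical
  refine (injective_iff_map_eq_one _).2 fun h hh => ?_
  obtain ⟨l, rfl, hne, hch⟩ := FreeGroup.exists_syllables h
  rcases l with _ | ⟨p, l⟩
  · simp
  exfalso
  set l' := p :: l with hl'
  let c : ℕ → Option ι := fun n => l'[n]?.map Prod.fst
  have hc : ∀ n i, c n = some i → c (n + 1) ≠ some i := by
    intro n i h1 h2
    simp only [c, Option.map_eq_some_iff] at h1 h2
    obtain ⟨a, ha, rfl⟩ := h1
    obtain ⟨b, hb, hab⟩ := h2
    obtain ⟨hn, rfl⟩ := List.getElem?_eq_some_iff.1 ha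
    obtain ⟨hn', rfl⟩ := List.getElem?_eq_some_iff.1 hb
    exact List.isChain_iff_getElem.1 hch n hn' hab.symm
  obtain ⟨ρ, hρ⟩ := hv (letterShift c)
  have hmap : (Units.map (PowerSeries.map ρ).toMonoidHom).comp (magnus v) =
      magnus (letterShift c) := by
    ext1 i
    ext1
    simp [oneAddUnit, hρ]
  have h1 : magnus (letterShift c) ((l'.map fun p => FreeGroup.of p.1 ^ p.2).prod) = 1 := by
    rw [← hmap, MonoidHom.comp_apply, hh, map_one]
  have h2 : ((l'.map fun p => (p.2 : Module.End ℝ (ℕ → ℝ)) * letterShift c p.1).map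
      oneAddUnit).prod = 1 := by
    rw [← h1, map_list_prod, List.map_map, List.map_map]
    congr 1
    refine List.map_congr_left fun p _ => ?_
    simp only [Function.comp_apply, map_zpow, magnus_of]
    exact (oneAddUnit_zpow_of_sq_eq_zero (letterShift_mul_self hc p.1) p.2).symm
  have h3 := (coeff_prod_oneAddUnit
    (l'.map fun p => (p.2 : Module.End ℝ (ℕ → ℝ)) * letterShift c p.1)).2
  rw [h2, List.length_map, Units.val_one, coeff_one, if_neg (by simp [hl'])] at h3
  have h4 := prod_letterShift_apply (c := c) l' (fun _ => 1) 0 fun n hn => by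
    simp [c, List.getElem?_eq_getElem hn]
  rw [← h3] at h4
  simp only [LinearMap.zero_apply, Pi.zero_apply, mul_one] at h4
  have h5 := List.prod_eq_zero_iff.1 h4.symm
  obtain ⟨q, hq, hq0⟩ := List.mem_map.1 h5
  exact hne q hq (by exact_mod_cast hq0)

end Magnus

/-! ### Invariant orders on the tensor algebra -/

section BasisOrder

variable {I M : Type*} [LinearOrder I] [AddCommGroup M] [Module ℝ M]

/-- The lexicographic order on a real vector space with ordered basis: a vector is positive when
its first non-zero coordinate is. -/
@[reducible]
noncomputable def Module.Basis.lexOrder (β : Module.Basis I ℝ M) : LinearOrder M :=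
  LinearOrder.lift' (fun f => toLex (β.repr f)) (toLex.injective.comp β.repr.injective)

theorem Module.Basis.lexOrder_isOrderedAddMonoid (β : Module.Basis I ℝ M) :
    letI := β.lexOrder
    IsOrderedAddMonoid M :=
  letI := β.lexOrder
  { add_le_add_left := fun a b h c => by
      change toLex (β.repr (a + c)) ≤ toLex (β.repr (b + c))
      rw [map_add β.repr a c, map_add β.repr b c]
      exact add_le_add_left (α := Lex (I →₀ ℝ)) h _ }

theorem Module.Basis.lexOrder_pos_iff (β : Module.Basis I ℝ M) (f : M) :
    β.lexOrder.lt 0 f ↔ ∃ i, (∀ j < i, β.repr f j = 0) ∧ 0 < β.repr f i := by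
  change toLex (β.repr 0) < toLex (β.repr f) ↔ _
  rw [map_zero, Finsupp.Lex.lt_iff]
  simp [eq_comm]

/-- A triangular endomorphism with positive diagonal preserves the lexicographic order. -/
theorem Module.Basis.lexOrder_pos_map (β : Module.Basis I ℝ M) (φ : M →ₗ[ℝ] M)
    (htri : ∀ i j, j < i → β.repr (φ (β i)) j = 0) (hdiag : ∀ i, 0 < β.repr (φ (β i)) i)
    {f : M} (hf : β.lexOrder.lt 0 f) : β.lexOrder.lt 0 (φ f) := by
  rw [lexOrder_pos_iff] at hf ⊢
  obtain ⟨i, h0, hi⟩ := hf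
  have hrepr : ∀ j, β.repr (φ f) j = (β.repr f).sum fun k a => a * β.repr (φ (β k)) j := by
    intro j
    conv_lhs => rw [← β.linearCombination_repr f]
    simp [Finsupp.linearCombination_apply, Finsupp.sum, map_sum]
  refine ⟨i, fun j hj => ?_, ?_⟩
  · rw [hrepr]
    refine Finset.sum_eq_zero fun k _ => ?_
    rcases lt_or_ge k i with hk | hk
    · simp [h0 k hk]
    · simp [htri k j (hj.trans_le hk)]
  · rw [hrepr, Finsupp.sum_eq_single i]
    · exact mul_pos hi (hdiag i)
    · intro k _ hki
      rcases hki.lt_or_gt with hk | hk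
      · simp [h0 k hk]
      · simp [htri k i hk]
    · simp

end BasisOrder

section TensorOrder

variable {κ V : Type*} [AddCommGroup V] [Module ℝ V]

/-- The basis of the tensor algebra given by the monomials in a basis of the vector space, indexed
by lists in order to have the lexicographic order on the index set. -/
noncomputable def Module.Basis.tensorList (b : Module.Basis κ ℝ V) :
    Module.Basis (List κ) ℝ (TensorAlgebra ℝ V) :=
  b.tensorAlgebra.reindex FreeMonoid.toList

theorem Module.Basis.tensorList_apply (b : Module.Basis κ ℝ V) (l : List κ) :
    b.tensorList l = (l.map fun i => TensorAlgebra.ι ℝ (b i)).prod := by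
  have : ∀ l : List κ, FreeAlgebra.basisFreeMonoid ℝ κ (FreeMonoid.ofList l) =
      (l.map (FreeAlgebra.ι ℝ)).prod := by
    intro l
    simp [FreeAlgebra.basisFreeMonoid, FreeAlgebra.equivMonoidAlgebraFreeMonoid,
      FreeMonoid.lift_apply]
  simp only [tensorList, Module.Basis.tensorAlgebra, Module.Basis.reindex_apply,
    Module.Basis.map_apply]
  erw [this l]
  simp [map_list_prod, Function.comp_def]

theorem Module.Basis.tensorList_cons (b : Module.Basis κ ℝ V) (i : κ) (l : List κ) :
    b.tensorList (i :: l) = TensorAlgebra.ι ℝ (b i) * b.tensorList l := by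
  simp [tensorList_apply]

theorem Module.Basis.induct {I M : Type*} [AddCommGroup M] [Module ℝ M]
    (β : Module.Basis I ℝ M) {p : M → Prop} (basis : ∀ i, p (β i)) (zero : p 0)
    (add : ∀ u v, p u → p v → p (u + v)) (smul : ∀ (r : ℝ) u, p u → p (r • u)) (u : M) : p u := by
  induction β.mem_span u using Submodule.span_induction with
  | mem u hu => obtain ⟨i, rfl⟩ := hu; exact basis i
  | zero => exact zero
  | add u v _ _ hu hv => exact add u v hu hv
  | smul r u _ hu => exact smul r u hu

theorem Module.Basis.tensorList_repr_ι_mul_cons (b : Module.Basis κ ℝ V) (u : V)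
    (a : TensorAlgebra ℝ V) (i : κ) (l : List κ) :
    b.tensorList.repr (TensorAlgebra.ι ℝ u * a) (i :: l) =
      b.repr u i * b.tensorList.repr a l := by
  classical
  refine b.induct (p := fun u => b.tensorList.repr (TensorAlgebra.ι ℝ u * a) (i :: l) =
    b.repr u i * b.tensorList.repr a l) (fun j => ?_) (by simp)
    (fun u v hu hv => by simp [add_mul, hu, hv])
    (fun r u hu => by simp [hu, mul_assoc]) u
  refine b.tensorList.induct (p := fun a => b.tensorList.repr (TensorAlgebra.ι ℝ (b j) * a) (i :: l) =
    b.repr (b j) i * b.tensorList.repr a l) (fun k => ?_) (by simp)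
    (fun u v hu hv => by simp [mul_add, hu, hv])
    (fun r u hu => by simp [hu, mul_left_comm]) a
  rw [← tensorList_cons]
  simp only [repr_self, Finsupp.single_apply, List.cons.injEq]
  by_cases h1 : j = i <;> by_cases h2 : k = l <;> simp [h1, h2]

theorem Module.Basis.tensorList_repr_ι_mul_nil (b : Module.Basis κ ℝ V) (u : V)
    (a : TensorAlgebra ℝ V) :
    b.tensorList.repr (TensorAlgebra.ι ℝ u * a) [] = 0 := by
  refine b.induct (p := fun u => b.tensorList.repr (TensorAlgebra.ι ℝ u * a) [] = 0) (fun j => ?_) (by simp)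
    (fun u v hu hv => by simp [add_mul, hu, hv])
    (fun r u hu => by simp [hu]) u
  refine b.tensorList.induct (p := fun a => b.tensorList.repr (TensorAlgebra.ι ℝ (b j) * a) [] = 0) (fun k => ?_) (by simp)
    (fun u v hu hv => by simp [mul_add, hu, hv])
    (fun r u hu => by simp [hu]) a
  rw [← tensorList_cons]
  simp

variable [LinearOrder κ]

/-- Triangularity with positive diagonal is inherited by the induced endomorphism of the tensor
algebra. -/
theorem Module.Basis.tensorList_triangular (b : Module.Basis κ ℝ V) {T : V →ₗ[ℝ] V}
    (htri : ∀ i j, j < i → b.repr (T (b i)) j = 0) (hdiag : ∀ i, 0 < b.repr (T (b i)) i)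
    (φ : TensorAlgebra ℝ V →ₐ[ℝ] TensorAlgebra ℝ V)
    (hφ : ∀ u, φ (TensorAlgebra.ι ℝ u) = TensorAlgebra.ι ℝ (T u)) (l : List κ) :
    (∀ l' < l, b.tensorList.repr (φ (b.tensorList l)) l' = 0) ∧
      0 < b.tensorList.repr (φ (b.tensorList l)) l := by
  induction l with
  | nil =>
    refine ⟨fun l' h => absurd h (by simp), ?_⟩
    have h1 : (1 : TensorAlgebra ℝ V) = b.tensorList [] := by simp [tensorList_apply]
    rw [← h1, map_one, h1]
    simp
  | cons i l ih =>
    rw [tensorList_cons, map_mul, hφ]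
    refine ⟨fun l' h => ?_, ?_⟩
    · rcases l' with _ | ⟨j, l'⟩
      · exact tensorList_repr_ι_mul_nil _ _ _
      · rw [tensorList_repr_ι_mul_cons]
        rcases List.cons_lt_cons_iff.1 h with h | ⟨rfl, h'⟩
        · simp [htri i j h]
        · simp [ih.1 l' h']
    · rw [tensorList_repr_ι_mul_cons]
      exact mul_pos (hdiag i) ih.2

theorem TensorAlgebra.surjective_of_surjective_on_ι {T : V → V} (hT : Function.Surjective T)
    (φ : TensorAlgebra ℝ V →ₐ[ℝ] TensorAlgebra ℝ V)
    (hφ : ∀ u, φ (TensorAlgebra.ι ℝ u) = TensorAlgebra.ι ℝ (T u)) : Function.Surjective φ := by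
  intro a
  induction a using TensorAlgebra.induction with
  | algebraMap r => exact ⟨algebraMap _ _ r, by simp⟩
  | ι w => obtain ⟨v, rfl⟩ := hT w; exact ⟨TensorAlgebra.ι ℝ v, hφ v⟩
  | mul a b ha hb => obtain ⟨a, rfl⟩ := ha; obtain ⟨b, rfl⟩ := hb; exact ⟨a * b, map_mul _ _ _⟩
  | add a b ha hb => obtain ⟨a, rfl⟩ := ha; obtain ⟨b, rfl⟩ := hb; exact ⟨a + b, map_add _ _ _⟩

end TensorOrder

/-! ### A cyclic operator with prescribed eigenvalues -/

section Bidiagonal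

variable {n : ℕ} (c : ℕ → ℝ)

/-- The standard basis vectors of `ℝⁿ`, continued by zero. -/
def stdVec (n i : ℕ) : Fin n → ℝ := fun j => if (j : ℕ) = i then 1 else 0

theorem stdVec_eq (i : Fin n) : stdVec n i = Pi.basisFun ℝ (Fin n) i := by
  ext j
  simp [stdVec, Pi.single_apply, Fin.ext_iff]

theorem stdVec_of_le {i : ℕ} (h : n ≤ i) : stdVec n i = 0 := by
  ext j
  simp [stdVec]
  omega

/-- The operator `eᵢ ↦ cᵢ eᵢ + eᵢ₊₁` on `ℝⁿ` (with `eₙ = 0`). -/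
def bidiagonal (n : ℕ) (c : ℕ → ℝ) : (Fin n → ℝ) →ₗ[ℝ] (Fin n → ℝ) where
  toFun u j := c j * u j + if h : (j : ℕ) = 0 then 0 else u ⟨j - 1, by omega⟩
  map_add' u v := by
    ext j
    by_cases h : (j : ℕ) = 0 <;> simp [h] <;> ring
  map_smul' r u := by
    ext j
    by_cases h : (j : ℕ) = 0 <;> simp [h] <;> ring

theorem bidiagonal_apply (u : Fin n → ℝ) (j : Fin n) :
    bidiagonal n c u j = c j * u j + if h : (j : ℕ) = 0 then 0 else u ⟨j - 1, by omega⟩ := rfl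

theorem bidiagonal_stdVec (i : ℕ) :
    bidiagonal n c (stdVec n i) = c i • stdVec n i + stdVec n (i + 1) := by
  ext j
  rw [bidiagonal_apply]
  simp only [stdVec, Pi.add_apply, Pi.smul_apply, smul_eq_mul]
  by_cases h : (j : ℕ) = 0
  · by_cases h2 : (j : ℕ) = i
    · subst h2; simp [h]
    · have h3 : ¬ 0 = i := by omega
      simp [h, h3]
  · by_cases h2 : (j : ℕ) = i
    · have h4 : ¬ ((j : ℕ) - 1 = i) := by omega
      subst h2; simp [h, h4]
    · have h6 : ((j : ℕ) - 1 = i) ↔ ((j : ℕ) = i + 1) := by omega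
      simp [h, h2, h6]

theorem bidiagonal_surjective (hc : ∀ i, 0 < c i) : Function.Surjective (bidiagonal n c) := by
  have key : ∀ k i, n ≤ i + k → stdVec n i ∈ LinearMap.range (bidiagonal n c) := by
    intro k
    induction k with
    | zero => intro i hi; rw [stdVec_of_le (by omega)]; exact zero_mem _
    | succ k ih =>
      intro i hi
      have h1 := ih (i + 1) (by omega)
      have h2 : bidiagonal n c (stdVec n i) ∈ LinearMap.range (bidiagonal n c) := ⟨_, rfl⟩
      rw [bidiagonal_stdVec] at h2
      have h3 := (LinearMap.range (bidiagonal n c)).smul_mem (c i)⁻¹ (sub_mem h2 h1)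
      rwa [add_sub_cancel_right, smul_smul, inv_mul_cancel₀ (hc i).ne', one_smul] at h3
  rw [← LinearMap.range_eq_top, eq_top_iff, ← (Pi.basisFun ℝ (Fin n)).span_eq,
    Submodule.span_le]
  rintro _ ⟨i, rfl⟩
  rw [← stdVec_eq]
  exact key n i (by omega)

/-- The orbit of the cyclic vector `e₀` under the operator `bidiagonal n c`. -/
def orbitVec (n : ℕ) (c : ℕ → ℝ) (i : ℕ) : Fin n → ℝ := (bidiagonal n c ^ i) (stdVec n 0)

theorem orbitVec_zero : orbitVec n c 0 = stdVec n 0 := rfl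

theorem orbitVec_succ (i : ℕ) :
    orbitVec n c (i + 1) = bidiagonal n c (orbitVec n c i) := by
  rw [orbitVec, pow_succ']; rfl

/-- The orbit and the standard basis are related by a unitriangular matrix. -/
theorem orbitVec_apply_of_le (i : ℕ) (j : Fin n) (h : i ≤ j) :
    orbitVec n c i j = if (j : ℕ) = i then 1 else 0 := by
  induction i generalizing j with
  | zero => rw [orbitVec_zero, stdVec]
  | succ i ih =>
    rw [orbitVec_succ, bidiagonal_apply, ih j (by omega), dif_neg (by omega),
      ih ⟨j - 1, by omega⟩ (by simp; omega), if_neg (by omega)]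
    have : ((j : ℕ) - 1 = i) ↔ ((j : ℕ) = i + 1) := by omega
    simp [this]

theorem stdVec_mem_span_orbitVec (i : ℕ) :
    stdVec n i ∈ Submodule.span ℝ (orbitVec n c '' Set.Iic i) := by
  induction i with
  | zero => exact Submodule.subset_span ⟨0, by simp, rfl⟩
  | succ i ih =>
    have h1 : stdVec n (i + 1) = bidiagonal n c (stdVec n i) - c i • stdVec n i := by
      rw [bidiagonal_stdVec, add_sub_cancel_left]
    rw [h1]
    refine sub_mem ?_ (Submodule.smul_mem _ _ (Submodule.span_mono ?_ ih))
    · have h2 := Submodule.mem_map_of_mem (f := bidiagonal n c) ih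
      rw [Submodule.map_span] at h2
      refine Submodule.span_mono ?_ h2
      rintro _ ⟨_, ⟨j, hj, rfl⟩, rfl⟩
      exact ⟨j + 1, by simpa using hj, orbitVec_succ c j⟩
    · exact Set.image_mono fun j hj => by simp at hj ⊢; omega

/-- The first `n` vectors of the orbit are a basis of `ℝⁿ`. -/
noncomputable def orbitBasis (n : ℕ) (c : ℕ → ℝ) : Module.Basis (Fin n) ℝ (Fin n → ℝ) :=
  basisOfTopLeSpanOfCardEqFinrank (fun i : Fin n => orbitVec n c i)
    (by
      rw [← (Pi.basisFun ℝ (Fin n)).span_eq, Submodule.span_le]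
      rintro _ ⟨i, rfl⟩
      rw [← stdVec_eq]
      refine Submodule.span_mono ?_ (stdVec_mem_span_orbitVec c i)
      rintro _ ⟨j, hj, rfl⟩
      exact ⟨⟨j, by simp at hj; omega⟩, rfl⟩)
    (by simp)

theorem orbitBasis_apply (i : Fin n) : orbitBasis n c i = orbitVec n c i := by
  simp [orbitBasis]

/-- For `k = n` the right-hand side is `0`: the cyclic vector is killed by `∏ (X - cᵢ)`. -/
theorem aeval_bidiagonal_prod (k : ℕ) :
    Polynomial.aeval (bidiagonal n c)
        (∏ i ∈ Finset.range k, (Polynomial.X - Polynomial.C (c i))) (stdVec n 0) = stdVec n k := by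
  induction k with
  | zero => simp
  | succ k ih =>
    rw [Finset.prod_range_succ, mul_comm, map_mul, Module.End.mul_apply, ih]
    simp [bidiagonal_stdVec]

end Bidiagonal

/-! ### The deformed automorphism of the power series ring -/

section Deformation

/-- The linear coefficient of the series `f`, together with all higher ones: `(f - f₀) / X`. -/
noncomputable def PowerSeries.shift {A : Type*} [Ring A] (f : A⟦X⟧) : A⟦X⟧ :=
  PowerSeries.mk fun n => coeff (n + 1) f

theorem PowerSeries.one_add_X_mul_shift {A : Type*} [Ring A] {f : A⟦X⟧}
    (hf : constantCoeff f = 1) : 1 + X * shift f = f := by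
  ext n
  rcases n with _ | n
  · simp [hf]
  · simp [shift, coeff_succ_X_mul, coeff_one]

/-- The homomorphism of the free group to the additive group `ℝ[X]` that sends the `i`-th generator
to `X ^ i`. It records the exponent sums. -/
noncomputable def exponentPoly (n : ℕ) : FreeGroup (Fin n) →* Multiplicative (Polynomial ℝ) :=
  FreeGroup.lift fun i => Multiplicative.ofAdd (Polynomial.X ^ (i : ℕ))

variable {n : ℕ} (c : ℕ → ℝ)

/-- The tensor algebra of `ℝⁿ`. -/
abbrev TAlg (n : ℕ) : Type := TensorAlgebra ℝ (Fin n → ℝ)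

/-- The vectors of the cyclic orbit, as elements of the tensor algebra. -/
noncomputable def orbitTensor (n : ℕ) (c : ℕ → ℝ) (i : ℕ) : TAlg n :=
  TensorAlgebra.ι ℝ (orbitVec n c i)

theorem magnus_orbitTensor_injective :
    Function.Injective (magnus fun i : Fin n => orbitTensor n c i) := by
  refine magnus_injective _ fun M => ?_
  refine ⟨(TensorAlgebra.lift ℝ ((orbitBasis n c).constr ℝ M)).toRingHom, fun i => ?_⟩
  have := (orbitBasis n c).constr_basis ℝ M i
  rw [orbitBasis_apply] at this
  simpa [orbitTensor] using this

theorem coeff_one_magnus_orbitTensor (W : FreeGroup (Fin n)) :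
    coeff 1 (magnus (fun i : Fin n => orbitTensor n c i) W : (TAlg n)⟦X⟧) =
      TensorAlgebra.ι ℝ
        (Polynomial.aeval (bidiagonal n c) (exponentPoly n W).toAdd (stdVec n 0)) := by
  let ψ : Polynomial ℝ →+ TAlg n :=
    { toFun := fun p => TensorAlgebra.ι ℝ (Polynomial.aeval (bidiagonal n c) p (stdVec n 0))
      map_zero' := by simp
      map_add' := by simp }
  have : magnusLinear (fun i : Fin n => orbitTensor n c i) =
      (AddMonoidHom.toMultiplicative ψ).comp (exponentPoly n) := by
    ext i
    rw [magnusLinear_of]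
    simp [exponentPoly, ψ, orbitTensor, orbitVec]
  rw [coeff_one_magnus, this]
  rfl

/-- For a series `z` with `z₀ = ι (T vₙ₋₁)`, where `T` is the operator `bidiagonal n c`, the
homomorphism `A → A⟦X⟧` on the tensor algebra that agrees with `T` on `vᵢ` for `i < n - 1` and
sends `vₙ₋₁` to `z`. As `vᵢ` and the standard basis are related by a unitriangular matrix, the last
coordinate of a vector is the same in both bases. For `n = 0` there is no last coordinate, and the
term with `z` is left out. -/
noncomputable def deformation (c : ℕ → ℝ) (z : (TAlg n)⟦X⟧) : TAlg n →ₐ[ℝ] (TAlg n)⟦X⟧ :=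
  TensorAlgebra.lift ℝ
    { toFun := fun u => C (TensorAlgebra.ι ℝ (bidiagonal n c u)) +
        (if h : n = 0 then (0 : ℝ) else u ⟨n - 1, by omega⟩) • (z - C (orbitTensor n c n))
      map_add' := fun u v => by
        by_cases h : n = 0
        · simp [h]
        · simp only [h, dite_false, map_add, Pi.add_apply, add_smul]; abel
      map_smul' := fun r u => by
        by_cases h : n = 0
        · ext k
          simp [h, coeff_C]
        · ext k
          simp [h, coeff_C, mul_smul] }

theorem deformation_ι (z : (TAlg n)⟦X⟧) (u : Fin n → ℝ) :
    deformation c z (TensorAlgebra.ι ℝ u) = C (TensorAlgebra.ι ℝ (bidiagonal n c u)) +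
        (if h : n = 0 then (0 : ℝ) else u ⟨n - 1, by omega⟩) • (z - C (orbitTensor n c n)) := by
  simp [deformation]

theorem deformation_orbitTensor (z : (TAlg n)⟦X⟧) {i : ℕ} (hi : i + 1 < n) :
    deformation c z (orbitTensor n c i) = C (orbitTensor n c (i + 1)) := by
  rw [orbitTensor, deformation_ι, dif_neg (by omega), orbitVec_apply_of_le _ _ _ (by simp; omega),
    if_neg (by simp; omega), zero_smul, add_zero, orbitTensor, orbitVec_succ]

theorem deformation_orbitTensor_last (z : (TAlg n)⟦X⟧) {i : ℕ} (hi : i + 1 = n) :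
    deformation c z (orbitTensor n c i) = z := by
  rw [orbitTensor, deformation_ι, dif_neg (by omega), orbitVec_apply_of_le _ _ _ (by simp; omega),
    if_pos (by simp; omega), one_smul, ← orbitVec_succ, hi, orbitTensor]
  abel

theorem constantCoeff_deformation_ι {z : (TAlg n)⟦X⟧}
    (hz : constantCoeff z = orbitTensor n c n) (u : Fin n → ℝ) :
    constantCoeff (deformation c z (TensorAlgebra.ι ℝ u)) =
      TensorAlgebra.ι ℝ (bidiagonal n c u) := by
  rw [deformation_ι]
  have : ∀ (r : ℝ) (f : (TAlg n)⟦X⟧), constantCoeff (r • f) = r • constantCoeff f := fun r f => by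
    rw [← coeff_zero_eq_constantCoeff_apply, ← coeff_zero_eq_constantCoeff_apply, coeff_smul]
  rw [map_add, this, map_sub, hz]
  simp

end Deformation

/-! ### Bi-ordered groups of power series -/

section UnipotentSeries

variable {A : Type*} [Ring A]

/-- The group of power series with constant coefficient `1`. -/
noncomputable def PowerSeries.unipotent (A : Type*) [Ring A] : Subgroup A⟦X⟧ˣ :=
  (Units.map (constantCoeff (R := A)).toMonoidHom).ker

theorem PowerSeries.mem_unipotent {u : A⟦X⟧ˣ} :
    u ∈ unipotent A ↔ constantCoeff (u : A⟦X⟧) = 1 := by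
  rw [unipotent, MonoidHom.mem_ker, Units.ext_iff]
  rfl

variable [LinearOrder A] [IsOrderedAddMonoid A]

open Classical in
/-- The lexicographic order on the group of power series with constant coefficient `1`: `u < v` when
the first non-zero coefficient of `v - u` is positive. -/
@[reducible]
noncomputable def PowerSeries.unipotentOrder (A : Type*) [Ring A] [LinearOrder A]
    [IsOrderedAddMonoid A] : LinearOrder (unipotent A) where
  le u v := u = v ∨ LexPos ((v : A⟦X⟧ˣ) - (u : A⟦X⟧ˣ) : A⟦X⟧)
  lt u v := LexPos ((v : A⟦X⟧ˣ) - (u : A⟦X⟧ˣ) : A⟦X⟧)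
  le_refl u := Or.inl rfl
  le_trans u v w := by
    rintro (rfl | h1) (rfl | h2)
    · exact Or.inl rfl
    · exact Or.inr h2
    · exact Or.inr h1
    · exact Or.inr (by simpa using h2.add h1)
  le_antisymm u v := by
    rintro (rfl | h1) (h2 | h2)
    · rfl
    · rfl
    · exact h2.symm
    · exact absurd (by simpa using h1.add h2) (not_lexPos_zero (A := A))
  lt_iff_le_not_ge u v := by
    constructor
    · refine fun h => ⟨Or.inr h, ?_⟩
      rintro (rfl | h2)
      · exact not_lexPos_zero (A := A) (by simpa using h)
      · exact not_lexPos_zero (A := A) (by simpa using h.add h2)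
    · rintro ⟨rfl | h, h2⟩
      · exact absurd (Or.inl rfl) h2
      · exact h
  le_total u v := by
    by_cases h : u = v
    · exact Or.inl (Or.inl h)
    · have h1 : ((v : A⟦X⟧ˣ) - (u : A⟦X⟧ˣ) : A⟦X⟧) ≠ 0 := by
        intro h0
        exact h (Subtype.ext (Units.ext (sub_eq_zero.1 h0).symm))
      rcases lexPos_or_lexPos_neg h1 with h2 | h2
      · exact Or.inl (Or.inr h2)
      · exact Or.inr (Or.inr (by simpa using h2))
  toDecidableLE := Classical.decRel _

theorem PowerSeries.unipotentOrder_lt_mul {u v g : unipotent A}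
    (h : (unipotentOrder A).lt u v) :
    (unipotentOrder A).lt (u * g) (v * g) ∧ (unipotentOrder A).lt (g * u) (g * v) := by
  have hg := mem_unipotent.1 g.2
  constructor
  · have := LexPos.mul_right h hg
    rw [sub_mul] at this
    exact this
  · have := LexPos.mul_left h hg
    rw [mul_sub] at this
    exact this

/-- A ring automorphism that preserves the lexicographic order and the constant coefficient `1`
restricts to an automorphism of the group of series with constant coefficient `1`. -/
noncomputable def PowerSeries.unipotentEquiv (Θ : A⟦X⟧ ≃+* A⟦X⟧)
    (h : ∀ f, constantCoeff (Θ f) = 1 ↔ constantCoeff f = 1) : unipotent A ≃* unipotent A where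
  toFun u := ⟨Units.mapEquiv Θ.toMulEquiv u, mem_unipotent.2 ((h _).2 (mem_unipotent.1 u.2))⟩
  invFun u := ⟨Units.mapEquiv Θ.symm.toMulEquiv u, mem_unipotent.2
    ((h _).1 (by simpa using mem_unipotent.1 u.2))⟩
  left_inv u := by ext1; ext1; simp
  right_inv u := by ext1; ext1; simp
  map_mul' u v := by ext1; ext1; simp

end UnipotentSeries

/-- The free group on `n` generators embeds in a bi-ordered group with an order-preserving
automorphism `Θ` which sends every generator to the next one, and the last one to a given word `W`.
By hypothesis, the characteristic polynomial on the abelianization of the endomorphism of the free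
group so described has positive roots `cᵢ`. -/
theorem exists_ordered_group_of_freeGroup (n : ℕ) (W : FreeGroup (Fin n)) (c : ℕ → ℝ)
    (hc : ∀ i, 0 < c i)
    (hW : Polynomial.X ^ n - (exponentPoly n W).toAdd =
      ∏ i ∈ Finset.range n, (Polynomial.X - Polynomial.C (c i))) :
    ∃ (U : Type) (_ : Group U) (_ : LinearOrder U) (Θ : U ≃* U) (u₀ : U)
      (μ : FreeGroup (Fin n) →* U),
      (∀ u v g : U, u < v → u * g < v * g ∧ g * u < g * v) ∧
      (∀ u v, u < v → Θ u < Θ v) ∧ Function.Injective μ ∧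
      (∀ i : Fin n, μ (FreeGroup.of i) = (Θ ^ (i : ℕ) : MulAut U) u₀) ∧
      μ W = (Θ ^ n : MulAut U) u₀ := by
  let T := bidiagonal n c
  let b := Pi.basisFun ℝ (Fin n)
  let μ₀ := magnus fun i : Fin n => orbitTensor n c i
  let z : (TAlg n)⟦X⟧ := shift (μ₀ W : (TAlg n)⟦X⟧)
  have hμz : (μ₀ W : (TAlg n)⟦X⟧) = 1 + X * z :=
    (one_add_X_mul_shift (constantCoeff_magnus _ W)).symm
  -- The cyclic vector is killed by the product in `hW`, so `W` has linear coefficient `T ^ n e₀`.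
  have hz : constantCoeff z = orbitTensor n c n := by
    have h1 := aeval_bidiagonal_prod (n := n) c n
    rw [← hW, stdVec_of_le le_rfl, map_sub, LinearMap.sub_apply, sub_eq_zero] at h1
    have h2 : constantCoeff z = coeff 1 (μ₀ W : (TAlg n)⟦X⟧) := by
      simp [z, shift, ← coeff_zero_eq_constantCoeff_apply]
    rw [h2, coeff_one_magnus_orbitTensor, ← h1, orbitTensor, orbitVec]
    simp
  let θ : TAlg n →+* (TAlg n)⟦X⟧ := (deformation c z).toRingHom
  let θ₀ : TAlg n →ₐ[ℝ] TAlg n := TensorAlgebra.lift ℝ (TensorAlgebra.ι ℝ ∘ₗ T)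
  have hθ₀ : ∀ u, θ₀ (TensorAlgebra.ι ℝ u) = TensorAlgebra.ι ℝ (T u) := by simp [θ₀]
  have hθ : ∀ a, constantCoeff (θ a) = θ₀ a := by
    intro a
    induction a using TensorAlgebra.induction with
    | algebraMap r =>
      have h1 : θ (algebraMap ℝ (TAlg n) r) = algebraMap ℝ _ r := (deformation c z).commutes r
      rw [h1, AlgHom.commutes]
      rw [PowerSeries.algebraMap_apply]
      exact constantCoeff_C _
    | ι u => rw [hθ₀]; exact constantCoeff_deformation_ι c hz u
    | mul a b ha hb => rw [map_mul, map_mul, map_mul, ha, hb]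
    | add a b ha hb => rw [map_add, map_add, map_add, ha, hb]
  let : LinearOrder (TAlg n) := b.tensorList.lexOrder
  have : IsOrderedAddMonoid (TAlg n) := b.tensorList.lexOrder_isOrderedAddMonoid
  -- `θ₀`, the reduction of `θ` modulo the variable, preserves the order of the tensor algebra, so it
  -- is injective and `θ` induces an order-preserving automorphism of the power series ring.
  have htri := b.tensorList_triangular (T := T)
    (fun i j hij => by
      have h0 : ¬ (j : ℕ) = i := by omega
      have h1 : ¬ (j : ℕ) = i + 1 := by omega
      rw [Pi.basisFun_repr, ← stdVec_eq, bidiagonal_stdVec]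
      simp [stdVec, h0, h1])
    (fun i => by
      rw [Pi.basisFun_repr, ← stdVec_eq, bidiagonal_stdVec]
      simp [stdVec, hc])
    θ₀ hθ₀
  have hpos : ∀ a : TAlg n, 0 < a → 0 < constantCoeff (θ a) := by
    intro a ha
    rw [hθ]
    exact b.tensorList.lexOrder_pos_map θ₀.toLinearMap (fun l l' h => (htri l).1 l' h)
      (fun l => (htri l).2) ha
  have hinj : Function.Injective fun a => constantCoeff (θ a) := by
    have : Function.Injective ((constantCoeff (R := TAlg n)).comp θ) := by
      refine (injective_iff_map_eq_zero _).2 fun a ha => ?_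
      by_contra hne
      rcases lt_or_gt_of_ne hne with h | h
      · have := hpos (-a) (by simpa using h)
        rw [map_neg, map_neg] at this
        exact (this.trans_eq (by simpa using ha)).false
      · exact ((hpos a h).trans_eq ha).false
    exact this
  have hsurj : Function.Surjective fun a => constantCoeff (θ a) := by
    simp_rw [hθ]
    exact TensorAlgebra.surjective_of_surjective_on_ι (bidiagonal_surjective c hc) θ₀ hθ₀
  let Θ₀ := bindEquiv θ ⟨hinj, hsurj⟩
  have hΘ₀ : ∀ f, Θ₀ f = bindHom θ f := fun _ => rfl
  have hconst : ∀ f, constantCoeff (Θ₀ f) = 1 ↔ constantCoeff f = 1 := by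
    intro f
    rw [hΘ₀, constantCoeff_bindHom]
    constructor
    · intro h
      exact hinj (by simp [h])
    · intro h
      simp [h]
  have hone : ∀ a : TAlg n, Θ₀ (oneAddUnit a : (TAlg n)⟦X⟧) = 1 + X * θ a := by
    intro a
    rw [hΘ₀]
    simp [oneAddUnit]
  let Θ := unipotentEquiv Θ₀ hconst
  have hΘ : ∀ u, ((Θ u : (TAlg n)⟦X⟧ˣ) : (TAlg n)⟦X⟧) = Θ₀ ((u : (TAlg n)⟦X⟧ˣ) : (TAlg n)⟦X⟧) :=
    fun _ => rfl
  let e : ℕ → unipotent (TAlg n) := fun i =>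
    ⟨oneAddUnit (orbitTensor n c i), mem_unipotent.2 (constantCoeff_oneAddUnit _)⟩
  let μ : FreeGroup (Fin n) →* unipotent (TAlg n) :=
    μ₀.codRestrict _ fun h => mem_unipotent.2 (constantCoeff_magnus _ h)
  have he : ∀ i, i < n → (Θ ^ i : MulAut (unipotent (TAlg n))) (e 0) = e i := by
    intro i
    induction i with
    | zero => intro _; rfl
    | succ i ih =>
      intro hi
      rw [pow_succ', MulAut.mul_apply, ih (by omega)]
      ext1; ext1
      rw [hΘ, hone]
      change 1 + X * deformation c z _ = _
      rw [deformation_orbitTensor c z hi]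
      rfl
  refine ⟨unipotent (TAlg n), inferInstance, unipotentOrder (TAlg n), Θ, e 0, μ, ?_, ?_, ?_, ?_, ?_⟩
  · exact fun u v g h => unipotentOrder_lt_mul h
  · intro u v h
    have := LexPos.bindHom hpos h
    rw [map_sub] at this
    exact this
  · intro g h hgh
    exact magnus_orbitTensor_injective c (congrArg Subtype.val hgh)
  · intro i
    rw [he i i.2]
    ext1
    simp [μ, μ₀, e]
  · -- For `n = 0` there is no last generator, but the cyclic vector and hence `e 0` are trivial.
    rcases n with _ | n
    · have hW1 : W = 1 := Subsingleton.elim _ _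
      rw [hW1, map_one, pow_zero]
      ext1; ext1
      change (1 : (TAlg 0)⟦X⟧) = 1 + X * C (orbitTensor 0 c 0)
      rw [orbitTensor, orbitVec_zero, stdVec_of_le le_rfl, map_zero, map_zero, mul_zero,
        add_zero]
    · rw [pow_succ', MulAut.mul_apply, he n (by omega)]
      ext1; ext1
      rw [hΘ, hone]
      change (μ₀ W : (TAlg (n + 1))⟦X⟧) = 1 + X * deformation c z _
      rw [deformation_orbitTensor_last c z rfl, hμz]

end NoncommutativePowerSeries

namespace TwoGen

/-! ### Bi-orderability of subgroups and of extensions by `ℤ` -/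

theorem BiOrderable.of_injective {G H : Type*} [Group G] [Group H] (f : G →* H)
    (hf : Function.Injective f) (hH : BiOrderable H) : BiOrderable G := by
  obtain ⟨_, h⟩ := hH
  refine ⟨LinearOrder.lift' f hf, fun u v g huv => ?_⟩
  have := h (f u) (f v) (f g) huv
  rwa [← map_mul, ← map_mul, ← map_mul, ← map_mul] at this

/-- If the cyclic factor acts by order-preserving automorphisms, then the lexicographic order, with
the cyclic factor dominant, is a bi-invariant order of the semidirect product. -/
theorem biOrderable_semidirectProduct {U : Type*} [Group U] [LinearOrder U]
    (hU : ∀ u v g : U, u < v → u * g < v * g ∧ g * u < g * v)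
    (φ : Multiplicative ℤ →* MulAut U) (hφ : ∀ z u v, u < v → φ z u < φ z v) :
    BiOrderable (U ⋊[φ] Multiplicative ℤ) := by
  refine ⟨LinearOrder.lift' (fun p => toLex (p.right, p.left)) ?_, fun u v g huv => ?_⟩
  · intro p q h
    simp only [EmbeddingLike.apply_eq_iff_eq, Prod.mk.injEq] at h
    exact SemidirectProduct.ext h.2 h.1
  · change toLex (u.right, u.left) < toLex (v.right, v.left) at huv
    change toLex ((u * g).right, (u * g).left) < toLex ((v * g).right, (v * g).left) ∧
      toLex ((g * u).right, (g * u).left) < toLex ((g * v).right, (g * v).left)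
    rw [Prod.Lex.toLex_lt_toLex] at huv ⊢
    rw [Prod.Lex.toLex_lt_toLex]
    simp only [SemidirectProduct.mul_right, SemidirectProduct.mul_left]
    rcases huv with h | ⟨h1, h2⟩
    · exact ⟨Or.inl (mul_lt_mul_left h _), Or.inl (mul_lt_mul_right h _)⟩
    · simp only at h1 h2
      rw [h1]
      exact ⟨Or.inr ⟨rfl, (hU _ _ _ h2).1⟩, Or.inr ⟨rfl, (hU _ _ _ (hφ _ _ _ h2)).2⟩⟩

/-- The powers of a strictly monotone automorphism of a linearly ordered group are strictly
monotone, including the negative ones. -/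
theorem zpow_mulAut_lt {U : Type*} [Group U] [LinearOrder U] (Θ : MulAut U)
    (hΘ : ∀ u v, u < v → Θ u < Θ v) (z : ℤ) (u v : U) (h : u < v) : (Θ ^ z) u < (Θ ^ z) v := by
  have h1 : StrictMono Θ := fun u v h => hΘ u v h
  have h2 : StrictMono (Θ⁻¹ : MulAut U) := by
    intro u v h
    rw [← h1.lt_iff_lt]
    simpa using h
  have h3 : ∀ (Ξ : MulAut U), StrictMono Ξ → ∀ n : ℕ, StrictMono (Ξ ^ n : MulAut U) := by
    intro Ξ hΞ n
    induction n with
    | zero => exact fun _ _ h => h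
    | succ n ih => exact fun _ _ h => by rw [pow_succ']; exact hΞ (ih h)
  obtain ⟨n, rfl | rfl⟩ := z.eq_nat_or_neg
  · rw [zpow_natCast]
    exact h3 Θ h1 n h
  · rw [zpow_neg, zpow_natCast, ← inv_pow]
    exact h3 _ h2 n h

/-! ### Ascending extensions -/

/-- The conjugate `x^{t^j}`. -/
def xConj (j : ℤ) : F := (t ^ j)⁻¹ * x * t ^ j

theorem xConj_conj (i j : ℤ) : (t ^ i)⁻¹ * xConj j * t ^ i = xConj (j + i) := by
  rw [xConj, xConj, zpow_add]
  group

theorem xConj_zpow (j k : ℤ) : xConj j ^ k = (t ^ j)⁻¹ * x ^ k * t ^ j := by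
  have := conj_zpow (i := k) (a := (t ^ j)⁻¹) (b := x)
  simpa [xConj] using this

/-- The homomorphism from the free group of rank `n` to `F` that sends the generators to
`n` consecutive conjugates of `x`, starting with `x^{t^e}`. -/
def block (n : ℕ) (e : ℤ) : FreeGroup (Fin n) →* F := FreeGroup.lift fun i => xConj (e + (i : ℕ))

theorem block_of {n : ℕ} (e : ℤ) (i : Fin n) :
    block n e (FreeGroup.of i) = xConj (e + (i : ℕ)) := by
  simp [block]

/-- Let `q : F → G` be a homomorphism such that the image `L` of a block of conjugates of `x`
contains the next conjugate, so that `L^t ≤ L`. Then every element of `F` is modulo `ker q` a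
conjugate by a power of `t` of an element of the block, times a power of `t`. -/
theorem exists_conj_block {G : Type*} [Group G] (q : F →* G) {n : ℕ} {e : ℤ}
    {W : FreeGroup (Fin n)} (hW : q (xConj (e + n)) = q (block n e W)) (g : F) :
    ∃ (a : ℤ) (k : ℕ) (h : FreeGroup (Fin n)),
      q ((t ^ k)⁻¹ * (g * t ^ a) * t ^ k) = q (block n e h) := by
  let L : Subgroup G := (q.comp (block n e)).range
  have hblock : ∀ h, q (block n e h) ∈ L := fun h => ⟨h, rfl⟩
  have hgen : ∀ i : Fin n, q (xConj (e + (i : ℕ) + 1)) ∈ L := by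
    intro i
    by_cases hi : (i : ℕ) + 1 < n
    · have := hblock (FreeGroup.of ⟨i + 1, hi⟩)
      rw [block_of] at this
      simpa [add_assoc] using this
    · have hn : e + (i : ℕ) + 1 = e + n := by omega
      rw [hn, hW]
      exact hblock W
  have hconj1 : ∀ l ∈ L, (q t)⁻¹ * l * q t ∈ L := by
    rintro _ ⟨h, rfl⟩
    have hmem : ∀ l, (q t)⁻¹ * l * q t = MulAut.conj (q t)⁻¹ l := by simp
    rw [hmem, ← MulEquiv.coe_toMonoidHom]
    induction h using FreeGroup.induction_on with
    | C1 => simp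
    | of i =>
      have h1 := hgen i
      rw [← xConj_conj] at h1
      rw [MulEquiv.coe_toMonoidHom, ← hmem, MonoidHom.comp_apply, block_of]
      simpa using h1
    | inv_of i hi => rw [map_inv (q.comp _), map_inv (MulEquiv.toMonoidHom _)]; exact inv_mem hi
    | mul g h hg hh => rw [map_mul, map_mul]; exact mul_mem hg hh
  have hconj : ∀ (k : ℕ) (l : G), l ∈ L → (q t ^ k)⁻¹ * l * q t ^ k ∈ L := by
    intro k
    induction k with
    | zero => intro l hl; simpa using hl
    | succ k ih =>
      intro l hl
      have := hconj1 _ (ih l hl)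
      rwa [show (q t)⁻¹ * ((q t ^ k)⁻¹ * l * q t ^ k) * q t =
        (q t ^ (k + 1))⁻¹ * l * q t ^ (k + 1) by rw [pow_succ]; group] at this
  have hmono : ∀ (g : F) (k j : ℕ), q ((t ^ k)⁻¹ * g * t ^ k) ∈ L →
      q ((t ^ (k + j))⁻¹ * g * t ^ (k + j)) ∈ L := by
    intro g k j hg
    have := hconj j _ hg
    rw [← map_pow, ← map_inv, ← map_mul, ← map_mul] at this
    rwa [show (t ^ j)⁻¹ * ((t ^ k)⁻¹ * g * t ^ k) * t ^ j =
      (t ^ (k + j))⁻¹ * g * t ^ (k + j) by rw [pow_add]; group] at this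
  -- The elements that are conjugated into the block by some power of `t` form a subgroup `S`.
  let S : Subgroup F :=
    { carrier := {g | ∃ k : ℕ, q ((t ^ k)⁻¹ * g * t ^ k) ∈ L}
      one_mem' := ⟨0, by simp⟩
      mul_mem' := by
        rintro g h ⟨k, hk⟩ ⟨j, hj⟩
        refine ⟨k + j, ?_⟩
        have h1 := mul_mem (hmono g k j hk) (hmono h j k hj)
        rw [add_comm j k, ← map_mul] at h1
        rwa [show (t ^ (k + j))⁻¹ * g * t ^ (k + j) * ((t ^ (k + j))⁻¹ * h * t ^ (k + j)) =
          (t ^ (k + j))⁻¹ * (g * h) * t ^ (k + j) by group] at h1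
      inv_mem' := by
        rintro g ⟨k, hk⟩
        refine ⟨k, ?_⟩
        have h1 := inv_mem hk
        rw [← map_inv] at h1
        rwa [show ((t ^ k)⁻¹ * g * t ^ k)⁻¹ = (t ^ k)⁻¹ * g⁻¹ * t ^ k by group] at h1 }
  have hS : ∀ g, g ∈ S ↔ ∃ k : ℕ, q ((t ^ k)⁻¹ * g * t ^ k) ∈ L := fun g => Iff.rfl
  have hSt : ∀ (a : ℤ) (g : F), g ∈ S → (t ^ a)⁻¹ * g * t ^ a ∈ S := by
    rintro a g ⟨k, hk⟩
    refine ⟨k + (-a).toNat, ?_⟩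
    have h1 := hmono g k a.toNat hk
    have h2 : (t ^ a) * t ^ (k + (-a).toNat) = t ^ (k + a.toNat) := by
      rw [← zpow_natCast, ← zpow_natCast, ← zpow_add]
      congr 1
      omega
    rwa [← h2, show (t ^ a * t ^ (k + (-a).toNat))⁻¹ * g * (t ^ a * t ^ (k + (-a).toNat)) =
      (t ^ (k + (-a).toNat))⁻¹ * ((t ^ a)⁻¹ * g * t ^ a) * t ^ (k + (-a).toNat) by group] at h1
  have hx0 : q (xConj e) ∈ L := by
    rcases Nat.eq_zero_or_pos n with rfl | hn
    · have := hblock W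
      rw [← hW] at this
      simpa using this
    · have := hblock (FreeGroup.of ⟨0, hn⟩)
      rw [block_of] at this
      simpa using this
  have hxe : xConj e ∈ S := ⟨0, by simpa using hx0⟩
  have hx : x ∈ S := by
    have := hSt (-e) _ hxe
    rw [xConj_conj, add_neg_cancel] at this
    simpa [xConj] using this
  have hmain : ∃ a : ℤ, g * t ^ a ∈ S := by
    have hinv : ∀ g : F, (∃ a : ℤ, g * t ^ a ∈ S) → ∃ a : ℤ, g⁻¹ * t ^ a ∈ S := by
      rintro g ⟨a, ha⟩
      refine ⟨-a, ?_⟩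
      have := hSt (-a) _ (inv_mem ha)
      rwa [show (t ^ (-a))⁻¹ * (g * t ^ a)⁻¹ * t ^ (-a) = g⁻¹ * t ^ (-a) by group] at this
    induction g using FreeGroup.induction_on with
    | C1 => exact ⟨0, by simp⟩
    | of i =>
      fin_cases i
      · exact ⟨0, by simpa [x] using hx⟩
      · refine ⟨-1, ?_⟩
        have : FreeGroup.of (1 : Fin 2) * t ^ (-1 : ℤ) = 1 := by simp [t]
        exact this ▸ one_mem S
    | inv_of i hi => exact hinv _ hi
    | mul g h hg hh =>
      obtain ⟨a, ha⟩ := hg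
      obtain ⟨b, hb⟩ := hh
      refine ⟨a + b, ?_⟩
      have := mul_mem ha (hSt a _ hb)
      rwa [show g * t ^ a * ((t ^ a)⁻¹ * (h * t ^ b) * t ^ a) = g * h * t ^ (a + b) by
        rw [add_comm, zpow_add]; group] at this
  obtain ⟨a, k, h, hk⟩ := hmain
  exact ⟨a, k, h, hk.symm⟩

/-- If the relator `w` expresses the conjugate of `x` after a block of `n` conjugates as a word `W` in
that block, and the polynomial of this recursion has positive roots, then `F / ⟨⟨w⟩⟩` embeds in the
semidirect product of a bi-ordered group `U` with `ℤ`, where `t⁻¹` acts on `U` by `Θ`. An element of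
the kernel is conjugate into the block, where the map is the injection `μ`. -/
theorem biOrderable_of_ascending {w : F} {n : ℕ} {e : ℤ} {W : FreeGroup (Fin n)} {c : ℕ → ℝ}
    (hc : ∀ i, 0 < c i)
    (hW : Polynomial.X ^ n - (exponentPoly n W).toAdd =
      ∏ i ∈ Finset.range n, (Polynomial.X - Polynomial.C (c i)))
    {P Q : FreeGroup (Fin n)} (hPQ : W = P⁻¹ * Q⁻¹)
    (hw : w = block n e P * xConj (e + n) * block n e Q) :
    BiOrderable (PresentedGroup ({w} : Set F)) := by
  obtain ⟨U, _, _, Θ, u₀, μ, hU, hΘ, hμ, hμi, hμW⟩ := exists_ordered_group_of_freeGroup n W c hc hW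
  let φ : Multiplicative ℤ →* MulAut U := zpowersHom (MulAut U) (Θ : MulAut U)⁻¹
  have hφ : ∀ z : ℤ, φ (Multiplicative.ofAdd z) = (Θ : MulAut U) ^ (-z) := by
    intro z
    rw [zpowersHom_apply, inv_zpow', toAdd_ofAdd]
  have hΓ : BiOrderable (U ⋊[φ] Multiplicative ℤ) := by
    refine biOrderable_semidirectProduct hU φ fun z u v huv => ?_
    obtain ⟨z, rfl⟩ := Multiplicative.ofAdd.surjective z
    rw [hφ]
    exact zpow_mulAut_lt _ hΘ _ _ _ huv
  let f : Fin 2 → U ⋊[φ] Multiplicative ℤ :=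
    ![SemidirectProduct.inl (((Θ : MulAut U) ^ (-e)) u₀),
      SemidirectProduct.inr (Multiplicative.ofAdd 1)]
  let ψ : F →* U ⋊[φ] Multiplicative ℤ := FreeGroup.lift f
  have hψx : ψ x = SemidirectProduct.inl (((Θ : MulAut U) ^ (-e)) u₀) := by simp [ψ, x, f]
  have hψt : ∀ z : ℤ, ψ (t ^ z) = SemidirectProduct.inr (Multiplicative.ofAdd z) := by
    intro z
    have : ψ t = SemidirectProduct.inr (Multiplicative.ofAdd 1) := by simp [ψ, t, f]
    rw [map_zpow, this, ← map_zpow, ← ofAdd_zsmul]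
    simp
  have hψ : ∀ j : ℤ, ψ (xConj j) = SemidirectProduct.inl (((Θ : MulAut U) ^ (j - e)) u₀) := by
    intro j
    rw [xConj, map_mul, map_mul, ← zpow_neg, hψt, hψt, hψx]
    have h1 : Multiplicative.ofAdd j = (Multiplicative.ofAdd (-j))⁻¹ := by simp
    rw [h1, ← SemidirectProduct.inl_aut, hφ, neg_neg, ← MulAut.mul_apply, ← zpow_add,
      sub_eq_add_neg]
  have hblock : ∀ h, ψ (block n e h) = SemidirectProduct.inl (μ h) := by
    have : ψ.comp (block n e) = SemidirectProduct.inl.comp μ := by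
      ext1 i
      rw [MonoidHom.comp_apply, MonoidHom.comp_apply, block_of, hψ, hμi, add_sub_cancel_left,
        zpow_natCast]
    exact fun h => DFunLike.congr_fun this h
  have hψw : ψ w = 1 := by
    rw [hw, map_mul, map_mul, hblock, hblock, hψ, add_sub_cancel_left, zpow_natCast, ← hμW,
      ← map_mul, ← map_mul, ← map_mul, ← map_mul, hPQ]
    simp
  let q : F →* PresentedGroup ({w} : Set F) := PresentedGroup.mk {w}
  have hqW : q (xConj (e + n)) = q (block n e W) := by
    have h1 : q w = 1 := PresentedGroup.one_of_mem rfl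
    replace h1 : q (block n e P * xConj (e + n) * block n e Q) = 1 := by rwa [← hw]
    rw [map_mul, map_mul] at h1
    rw [hPQ, map_mul, map_inv, map_inv, map_mul, map_inv, map_inv]
    rw [eq_inv_mul_iff_mul_eq]
    exact eq_inv_of_mul_eq_one_left h1
  let ψ' : PresentedGroup ({w} : Set F) →* U ⋊[φ] Multiplicative ℤ :=
    PresentedGroup.toGroup (f := f) (by simpa using hψw)
  have hψ' : ∀ g, ψ' (q g) = ψ g := fun g => rfl
  refine BiOrderable.of_injective ψ' ((injective_iff_map_eq_one _).2 fun g hg => ?_) hΓ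
  obtain ⟨g, rfl⟩ := PresentedGroup.mk_surjective _ g
  change ψ g = 1 at hg
  obtain ⟨a, k, h, hk⟩ := exists_conj_block q hqW g
  have h1 : ψ (t ^ a) = SemidirectProduct.inl (μ h) := by
    rw [← hblock, ← hψ', ← hψ', ← hk, hψ', hψ', map_mul, map_mul, map_mul, hg, one_mul, ← map_mul,
      ← map_mul, ← zpow_natCast]
    congr 1
    group
  rw [hψt] at h1
  have h2 := congrArg SemidirectProduct.right h1
  have h3 := congrArg SemidirectProduct.left h1
  simp only [SemidirectProduct.left_inr, SemidirectProduct.left_inl, SemidirectProduct.right_inr,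
    SemidirectProduct.right_inl, ofAdd_eq_one] at h2 h3
  have h4 : h = 1 := hμ (by rw [← h3, map_one])
  rw [h2, h4, map_one, map_one, zpow_zero, mul_one, map_mul, map_mul, map_inv] at hk
  rw [mul_eq_one_iff_eq_inv, mul_eq_left] at hk
  exact hk

end TwoGen

/-! ### Monic words -/

open Polynomial in
/-- A monic real polynomial all of whose complex roots are real and positive is a product of linear
factors over `ℝ`. -/
theorem Polynomial.Monic.eq_prod_of_positive_roots (n : ℕ) {p : ℝ[X]} (hp : p.Monic)
    (hn : p.natDegree = n)
    (hroots : ∀ z : ℂ, aeval z p = 0 → ∃ ρ : ℝ, 0 < ρ ∧ z = (ρ : ℂ)) :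
    ∃ c : ℕ → ℝ, (∀ i, 0 < c i) ∧ p = ∏ i ∈ Finset.range n, (X - C (c i)) := by
  induction n generalizing p with
  | zero => exact ⟨fun _ => 1, fun _ => one_pos, by simpa using hp.natDegree_eq_zero.1 hn⟩
  | succ n ih =>
    obtain ⟨z, hz⟩ := IsAlgClosed.exists_aeval_eq_zero ℂ p
      (by rw [degree_eq_natDegree hp.ne_zero, hn]; exact_mod_cast n.succ_ne_zero)
    obtain ⟨ρ, hρ, rfl⟩ := hroots z hz
    have hroot : p.IsRoot ρ := by
      have h1 : aeval (algebraMap ℝ ℂ ρ) p = 0 := hz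
      rw [aeval_algebraMap_apply] at h1
      simpa using h1
    obtain ⟨q, rfl⟩ := dvd_iff_isRoot.2 hroot
    have hq : q.Monic := (monic_X_sub_C ρ).of_mul_monic_left hp
    have hqn : q.natDegree = n := by
      rw [(monic_X_sub_C ρ).natDegree_mul hq, natDegree_X_sub_C] at hn
      omega
    obtain ⟨c, hc, hqc⟩ := ih hq hqn fun z hz => hroots z (by rw [map_mul, hz, mul_zero])
    refine ⟨Function.update c n ρ, fun i => ?_, ?_⟩
    · by_cases h : i = n
      · subst h; simpa using hρ
      · simpa [h] using hc i
    · rw [Finset.prod_range_succ, Function.update_self, mul_comm, hqc]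
      congr 1
      refine Finset.prod_congr rfl fun i hi => ?_
      rw [Function.update_of_ne (Finset.mem_range.1 hi).ne]

namespace TwoGen

theorem word_eq_prod {r : ℕ} (m d : Fin r → ℤ) :
    word m d = ((List.finRange r).map fun i => xConj (d i) ^ m i).prod := by
  rw [word, List.ofFn_eq_map]
  simp_rw [xConj_zpow]

theorem toAdd_exponentPoly_of_zpow {n : ℕ} (i : Fin n) (k : ℤ) :
    (exponentPoly n (FreeGroup.of i ^ k)).toAdd =
      Polynomial.C (k : ℝ) * Polynomial.X ^ (i : ℕ) := by
  simp [exponentPoly]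

/-- The relation of a monic word is solved for the conjugate of `x` with the largest index, which
occurs only once, and the exponent sums of the solution are read off from `A_w`. -/
theorem biOrderable_presentedGroup_word {r : ℕ} (m d : Fin r → ℤ) (hmonic : IsMonic m d)
    (hroots : ∀ z : ℂ, Polynomial.aeval z (poly m d) = 0 → ∃ ρ : ℝ, 0 < ρ ∧ z = (ρ : ℂ)) :
    BiOrderable (PresentedGroup ({word m d} : Set F)) := by
  obtain ⟨⟨⟨⟨-, hN⟩, htidy⟩, k, hk⟩, hmk⟩ := hmonic
  replace hmk : m k = 1 := hmk k (by simp [hk])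
  have hdk : d k = top m d := by
    have : k ∈ tau d (top m d) := by simp [hk]
    simpa [tau] using this
  have hle : low m d ≤ top m d := (isLeast_low m d hN).2 (isGreatest_top m d hN).1
  set e := low m d with he
  set n := (top m d - e).toNat with hn
  have hrange : ∀ i, i ≠ k → e ≤ d i ∧ d i < top m d := by
    intro i hik
    have hmem : i ∈ tau d (d i) := by simp [tau]
    have h1 : ¬ (top m d < d i ∨ d i < e) := fun h => by
      rw [htidy _ h] at hmem
      simp at hmem
    have h2 : d i ≠ top m d := by
      intro h
      rw [h, hk, Finset.mem_singleton] at hmem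
      exact hik hmem
    omega
  have hlt : ∀ i, i ≠ k → (d i - e).toNat < n := fun i hik => by
    have := hrange i hik
    omega
  let g : Fin r → FreeGroup (Fin n) := fun i =>
    if h : (d i - e).toNat < n then FreeGroup.of ⟨_, h⟩ ^ m i else 1
  have hblock : ∀ i, i ≠ k → block n e (g i) = xConj (d i) ^ m i := by
    intro i hik
    have h1 := (hrange i hik).1
    have h2 : e + (((d i - e).toNat : ℕ) : ℤ) = d i := by omega
    simp only [g, dif_pos (hlt i hik), map_zpow, block_of, h2]
  have hexp : ∀ i, i ≠ k → (exponentPoly n (g i)).toAdd =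
      Polynomial.C (m i : ℝ) * Polynomial.X ^ (d i - e).toNat := by
    intro i hik
    simp only [g, dif_pos (hlt i hik), toAdd_exponentPoly_of_zpow]
  -- `l₁` and `l₂` are the factors of the word before and after the one with the largest index.
  obtain ⟨l₁, l₂, hl⟩ := List.append_of_mem (List.mem_finRange k)
  have hnodup := List.nodup_finRange r
  rw [hl, List.nodup_middle, List.nodup_cons, List.mem_append, not_or] at hnodup
  have h₁ : ∀ i ∈ l₁, i ≠ k := fun i hi h => hnodup.1.1 (h ▸ hi)
  have h₂ : ∀ i ∈ l₂, i ≠ k := fun i hi h => hnodup.1.2 (h ▸ hi)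
  have hbl : ∀ l : List (Fin r), (∀ i ∈ l, i ≠ k) →
      block n e (l.map g).prod = (l.map fun i => xConj (d i) ^ m i).prod := by
    intro l hl
    rw [map_list_prod, List.map_map]
    exact congrArg _ (List.map_congr_left fun i hi => hblock i (hl i hi))
  have hel : ∀ l : List (Fin r), (∀ i ∈ l, i ≠ k) → (exponentPoly n (l.map g).prod).toAdd =
      (l.map fun i => Polynomial.C (m i : ℝ) * Polynomial.X ^ (d i - e).toNat).sum := by
    intro l hl
    induction l with
    | nil => simp
    | cons i l ih =>
      rw [List.map_cons, List.prod_cons, map_mul, toAdd_mul, List.map_cons, List.sum_cons,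
        hexp i (hl i (by simp)), ih fun j hj => hl j (List.mem_cons_of_mem _ hj)]
  set p : Polynomial ℝ := (poly m d).map (Int.castRingHom ℝ) with hp
  have hpsum : p = ∑ i, Polynomial.C (m i : ℝ) * Polynomial.X ^ (d i - e).toNat := by
    simp [hp, poly, Polynomial.map_sum, he]
  have hpmonic : p.Monic ∧ p.natDegree = n := by
    have hdeg : (∑ i ∈ Finset.univ.erase k,
        Polynomial.C (m i : ℝ) * Polynomial.X ^ (d i - e).toNat).degree < (n : WithBot ℕ) := by
      refine Polynomial.mem_degreeLT.1 (sum_mem fun i hi => Polynomial.mem_degreeLT.2 ?_)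
      refine (Polynomial.degree_C_mul_X_pow_le _ _).trans_lt ?_
      exact_mod_cast hlt i (Finset.ne_of_mem_erase hi)
    rw [hpsum, ← Finset.add_sum_erase _ _ (Finset.mem_univ k), hmk, hdk, ← hn]
    simp only [Int.cast_one, map_one, one_mul]
    refine ⟨Polynomial.monic_X_pow_add hdeg, ?_⟩
    rw [Polynomial.natDegree_add_eq_left_of_degree_lt (by rwa [Polynomial.degree_X_pow]),
      Polynomial.natDegree_X_pow]
  obtain ⟨c, hc, hpc⟩ := hpmonic.1.eq_prod_of_positive_roots n hpmonic.2 fun z hz =>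
    hroots z (by
      rwa [hp, ← algebraMap_int_eq, Polynomial.aeval_map_algebraMap] at hz)
  refine biOrderable_of_ascending (n := n) (e := e) (P := (l₁.map g).prod) (Q := (l₂.map g).prod)
    hc ?_ rfl ?_
  · rw [← hpc, hpsum, ← List.sum_ofFn, List.ofFn_eq_map, hl, List.map_append, List.map_cons,
      List.sum_append, List.sum_cons, map_mul, map_inv, map_inv, toAdd_mul, toAdd_inv, toAdd_inv,
      hel _ h₁, hel _ h₂, hmk, hdk, ← hn]
    simp only [Int.cast_one, map_one, one_mul]
    abel
  · have h3 : e + (n : ℤ) = d k := by omega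
    rw [word_eq_prod, hl, List.map_append, List.map_cons, List.prod_append, List.prod_cons,
      hbl _ h₁, hbl _ h₂, h3, hmk, zpow_one, mul_assoc]

end TwoGen

theorem theoremC {r : ℕ} (m d : Fin r → ℤ) (w : TwoGen.F) (hw : w = TwoGen.word m d)
    (hmonic : TwoGen.IsMonic m d)
    (hroots : ∀ z : ℂ, Polynomial.aeval z (TwoGen.poly m d) = 0 → ∃ ρ : ℝ, 0 < ρ ∧ z = (ρ : ℂ))
    {G : Type*} [Group G] (φ : PresentedGroup ({w} : Set TwoGen.F) ≃* G) :
    TwoGen.BiOrderable G := by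
  subst hw
  exact TwoGen.BiOrderable.of_injective φ.symm.toMonoidHom φ.symm.injective
    (TwoGen.biOrderable_presentedGroup_word m d hmonic hroots)
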